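/- **Setting.** Let $\ell>0$, $I=(-\ell/2,\ell/2)$ and $S=I\times(-1/2,1/2)$. Let $Q_2:\mathbb{R}^{2\times2}_{\rm sym}\to[0,+\infty)$ be a positive definite quadratic form on the space of real symmetric $2\times 2$ matrices, and for $\kappa,\tau\in\mathbb{R}$ let $$Q_1(\kappa,\tau)=\min_{\gamma\in\mathbb{R}}Q_2\begin{pmatrix}\kappa&\tau\\ \tau&\gamma\end{pmatrix}.$$ For an open set $\Omega$ in $\mathbb{R}$ or $\mathbb{R}^2$ let $W^{1,2}_{\langle0\rangle}(\Omega)$ be the set of $g\in W^{1,2}(\Omega)$ with $\int_\Omega g\,dx=0$, and let $W^{2,2}_{\langle0\rangle}(\Omega)$ be the set of $g\in W^{2,2}(\Omega)$ with $\int_\Omega g\,dx=0$ and $\int_\Omega\nabla g\,dx=0$. For $\varepsilon>0$ and $w\in W^{2,2}(S)$ let $$\nabla_\varepsilon w=\Big(\partial_1w,\frac1\varepsilon\partial_2w\Big),\qquad \nabla^2_\varepsilon w=\begin{pmatrix}\partial^2_{11}w&\frac1\varepsilon\partial^2_{12}w\\ \frac1\varepsilon\partial^2_{12}w&\frac1{\varepsilon^2}\partial^2_{22}w\end{pmatrix},\qquad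 J^{ben}_\varepsilon(w)=\frac1{24}\int_SQ_2(\nabla^2_\varepsilon w)\,dx,$$ and for $w\in W^{2,2}_{\langle0\rangle}(I)$, $\vartheta\in W^{1,2}_{\langle0\rangle}(I)$ let $$J^{LvK}(w,\vartheta)=\frac1{24}\int_IQ_1(w'',\vartheta')\,dx_1.$$ Functions on $I$ are regarded as functions on $S$ that do not depend on $x_2$. **Theorem.** As $\varepsilon\to0$, the functionals $J^{ben}_\varepsilon$ $\Gamma$-converge to $J^{LvK}$ in the following sense. (i) (liminf inequality) Let $\varepsilon_n>0$ with $\varepsilon_n\to0$, let $w_n\in W^{2,2}_{\langle0\rangle}(S)$, $w\in W^{2,2}_{\langle0\rangle}(I)$ and $\vartheta\in W^{1,2}_{\langle0\rangle}(I)$ be such that $w_n\rightharpoonup w$ weakly in $W^{2,2}(S)$ and $\nabla_{\varepsilon_n}w_n\rightharpoonup(w',\vartheta)$ weakly in $W^{1,2}(S;\mathbb{R}^2)$. Then $$\liminf_{n\to\infty}J^{ben}_{\varepsilon_n}(w_n)\ge J^{LvK}(w,\vartheta).$$ (ii) (recovery sequence) For every $w\in W^{2,2}_{\langle0\rangle}(I)$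 and $\vartheta\in W^{1,2}_{\langle0\rangle}(I)$ there is a family $(w_\varepsilon)_{\varepsilon>0}\subset W^{2,2}_{\langle0\rangle}(S)$ such that, as $\varepsilon\to0^+$, $w_\varepsilon\rightharpoonup w$ weakly in $W^{2,2}(S)$, $\nabla_\varepsilon w_\varepsilon\rightharpoonup(w',\vartheta)$ weakly in $W^{1,2}(S;\mathbb{R}^2)$, and $$\limsup_{\varepsilon\to0}J^{ben}_\varepsilon(w_\varepsilon)\le J^{LvK}(w,\vartheta).$$ -/

import Mathlib

open MeasureTheory Filter Topology
open scoped ContDiff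

namespace NarrowStrip

noncomputable section

section Sobolev

variable {E : Type*} [NormedAddCommGroup E] [NormedSpace ℝ E] [MeasureSpace E]

/-- `φ ∈ C_c^∞(Ω)`. -/
structure IsTestFunction (Ω : Set E) (φ : E → ℝ) : Prop where
  smooth : ContDiff ℝ ∞ φ
  compact : HasCompactSupport φ
  support_subset : tsupport φ ⊆ Ω

/-- The Lebesgue space `L²(Ω)`. -/
abbrev L2 (Ω : Set E) : Type _ := Lp ℝ 2 ((volume : Measure E).restrict Ω)

/-- `g` is the weak derivative of `f` in the direction `e` on `Ω`:
`∫_Ω f ∂_e φ = - ∫_Ω g φ` for every test function `φ`. -/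
def IsWeakDeriv (Ω : Set E) (e : E) (f g : L2 Ω) : Prop :=
  ∀ φ : E → ℝ, IsTestFunction Ω φ →
    ∫ x in Ω, f x * fderiv ℝ φ x e = - ∫ x in Ω, g x * φ x

theorem isWeakDeriv_zero (Ω : Set E) (e : E) : IsWeakDeriv Ω e 0 0 := by
  intro φ _
  have h0 : ((0 : L2 Ω) : E → ℝ) =ᵐ[volume.restrict Ω] 0 := Lp.coeFn_zero _ _ _
  have h1 : ∫ x in Ω, (0 : L2 Ω) x * fderiv ℝ φ x e = 0 := by
    apply integral_eq_zero_of_ae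
    filter_upwards [h0] with x hx
    rw [hx, Pi.zero_apply, zero_mul]
  have h2 : ∫ x in Ω, (0 : L2 Ω) x * φ x = 0 := by
    apply integral_eq_zero_of_ae
    filter_upwards [h0] with x hx
    rw [hx, Pi.zero_apply, zero_mul]
  rw [h1, h2, neg_zero]

theorem IsWeakDeriv.smul {Ω : Set E} {e : E} {f g : L2 Ω} (c : ℝ) (h : IsWeakDeriv Ω e f g) :
    IsWeakDeriv Ω e (c • f) (c • g) := by
  intro φ hφ
  have key : ∀ (u : L2 Ω) (ψ : E → ℝ),
      ∫ x in Ω, (c • u : L2 Ω) x * ψ x = c * ∫ x in Ω, u x * ψ x := by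
    intro u ψ
    rw [← integral_const_mul]
    apply integral_congr_ae
    filter_upwards [Lp.coeFn_smul c u] with x hx
    rw [hx, Pi.smul_apply, smul_eq_mul, mul_assoc]
  rw [key, key, h φ hφ, mul_neg]

variable [BorelSpace E] [IsFiniteMeasureOnCompacts (volume : Measure E)]

theorem IsTestFunction.integrable_mul {Ω : Set E} {φ : E → ℝ} (hφ : IsTestFunction Ω φ)
    (f : L2 Ω) : Integrable (fun x => f x * φ x) (volume.restrict Ω) :=
  (Lp.memLp f).integrable_mul (q := 2)
    ((hφ.smooth.continuous.memLp_of_hasCompactSupport hφ.compact).restrict Ω)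

theorem IsTestFunction.integrable_mul_fderiv {Ω : Set E} {φ : E → ℝ} (hφ : IsTestFunction Ω φ)
    (e : E) (f : L2 Ω) : Integrable (fun x => f x * fderiv ℝ φ x e) (volume.restrict Ω) :=
  (Lp.memLp f).integrable_mul (q := 2)
    ((((hφ.smooth.continuous_fderiv (by simp)).clm_apply continuous_const
      ).memLp_of_hasCompactSupport (hφ.compact.fderiv_apply ℝ e)).restrict Ω)

theorem IsWeakDeriv.add {Ω : Set E} {e : E} {f g f' g' : L2 Ω} (h : IsWeakDeriv Ω e f g)
    (h' : IsWeakDeriv Ω e f' g') : IsWeakDeriv Ω e (f + f') (g + g') := by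
  intro φ hφ
  have key : ∀ (u v : L2 Ω) (ψ : E → ℝ), Integrable (fun x => u x * ψ x) (volume.restrict Ω) →
      Integrable (fun x => v x * ψ x) (volume.restrict Ω) →
      ∫ x in Ω, (u + v : L2 Ω) x * ψ x = (∫ x in Ω, u x * ψ x) + ∫ x in Ω, v x * ψ x := by
    intro u v ψ hu hv
    rw [← integral_add hu hv]
    apply integral_congr_ae
    filter_upwards [Lp.coeFn_add u v] with x hx
    rw [hx, Pi.add_apply, add_mul]
  rw [key _ _ _ (hφ.integrable_mul_fderiv e f) (hφ.integrable_mul_fderiv e f'),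
    key _ _ _ (hφ.integrable_mul g) (hφ.integrable_mul g'), h φ hφ, h' φ hφ, neg_add]

variable {ι : Type*} [Fintype ι]

/-- The Hilbert space `W^{1,2}(Ω)`, with respect to the coordinate directions `b i`. An element
is a function `f ∈ L²(Ω)` together with its weak partial derivatives `∂_i f ∈ L²(Ω)` (which are
determined by `f` when `Ω` is open); the norm is
`‖f‖² = ‖f‖²_{L²} + ∑ i, ‖∂_i f‖²_{L²}`. -/
def W12Submodule (b : ι → E) (Ω : Set E) :
    Submodule ℝ (WithLp 2 (L2 Ω × PiLp 2 (fun _ : ι => L2 Ω))) where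
  carrier := {u | ∀ i, IsWeakDeriv Ω (b i) u.fst (u.snd i)}
  zero_mem' := fun i => isWeakDeriv_zero Ω (b i)
  add_mem' := fun hu hv i => (hu i).add (hv i)
  smul_mem' := fun c _ hu i => (hu i).smul c

/-- `W^{1,2}(Ω)` as a normed space. -/
abbrev W12 (b : ι → E) (Ω : Set E) : Type _ := W12Submodule b Ω

/-- The underlying function of an element of `W^{1,2}(Ω)`. -/
def W12.toL2 {b : ι → E} {Ω : Set E} (u : W12 b Ω) : L2 Ω := u.1.fst

/-- The weak partial derivative `∂_i u` of `u ∈ W^{1,2}(Ω)`. -/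
def W12.partialDeriv {b : ι → E} {Ω : Set E} (u : W12 b Ω) (i : ι) : L2 Ω := u.1.snd i

/-- The Hilbert space `W^{2,2}(Ω)`. An element is a function `f ∈ L²(Ω)` together with its weak
partial derivatives `∂_i f`, which are required to belong to `W^{1,2}(Ω)`; the norm is
`‖f‖² = ‖f‖²_{L²} + ∑ i, ‖∂_i f‖²_{L²} + ∑ i, ∑ j, ‖∂_j ∂_i f‖²_{L²}`. -/
def W22Submodule (b : ι → E) (Ω : Set E) :
    Submodule ℝ (WithLp 2 (L2 Ω × PiLp 2 (fun _ : ι => W12 b Ω))) where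
  carrier := {u | ∀ i, IsWeakDeriv Ω (b i) u.fst (W12.toL2 (u.snd i))}
  zero_mem' := fun i => isWeakDeriv_zero Ω (b i)
  add_mem' := fun hu hv i => (hu i).add (hv i)
  smul_mem' := fun c _ hu i => (hu i).smul c

/-- `W^{2,2}(Ω)` as a normed space. -/
abbrev W22 (b : ι → E) (Ω : Set E) : Type _ := W22Submodule b Ω

/-- The underlying function of an element of `W^{2,2}(Ω)`. -/
def W22.toL2 {b : ι → E} {Ω : Set E} (u : W22 b Ω) : L2 Ω := u.1.fst

/-- The weak partial derivative `∂_i u ∈ W^{1,2}(Ω)` of `u ∈ W^{2,2}(Ω)`. -/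
def W22.partialDeriv {b : ι → E} {Ω : Set E} (u : W22 b Ω) (i : ι) : W12 b Ω := u.1.snd i

/-- `u ∈ W^{1,2}_{⟨0⟩}(Ω)`: zero average. -/
def W12.ZeroMean {b : ι → E} {Ω : Set E} (u : W12 b Ω) : Prop :=
  ∫ x in Ω, u.toL2 x = 0

/-- `u ∈ W^{2,2}_{⟨0⟩}(Ω)`: zero average and zero average gradient. -/
def W22.ZeroMean {b : ι → E} {Ω : Set E} (u : W22 b Ω) : Prop :=
  (∫ x in Ω, u.toL2 x) = 0 ∧ ∀ i, ∫ x in Ω, (u.partialDeriv i).toL2 x = 0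

/-- Weak convergence `u ⇀ v` along `l` in a real normed space, that is, convergence in the
weak topology. -/
def WeakTendsto {α V : Type*} [NormedAddCommGroup V] [NormedSpace ℝ V] (u : α → V) (l : Filter α)
    (v : V) : Prop :=
  Tendsto (fun a => toWeakSpace ℝ V (u a)) l (𝓝 (toWeakSpace ℝ V v))

end Sobolev

section Strip

/-- The interval `I = (-ℓ/2, ℓ/2)`. -/
def I (ℓ : ℝ) : Set ℝ := Set.Ioo (-ℓ / 2) (ℓ / 2)

/-- The rescaled strip `S = I × (-1/2, 1/2)`. -/
def S (ℓ : ℝ) : Set (ℝ × ℝ) := I ℓ ×ˢ Set.Ioo (-1 / 2) (1 / 2)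

/-- `W^{1,2}(I)`. -/
abbrev W12I (ℓ : ℝ) := W12 (fun _ : Fin 1 => (1 : ℝ)) (I ℓ)

/-- `W^{2,2}(I)`. -/
abbrev W22I (ℓ : ℝ) := W22 (fun _ : Fin 1 => (1 : ℝ)) (I ℓ)

/-- The canonical basis of the plane; index `0` stands for `x₁` and index `1` for `x₂`. -/
def e : Fin 2 → ℝ × ℝ := ![(1, 0), (0, 1)]

/-- `W^{1,2}(S)`. -/
abbrev W12S (ℓ : ℝ) := W12 e (S ℓ)

/-- `W^{2,2}(S)`. -/
abbrev W22S (ℓ : ℝ) := W22 e (S ℓ)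

/-- `W^{1,2}(S; ℝ²)`. -/
abbrev W12SVec (ℓ : ℝ) := PiLp 2 (fun _ : Fin 2 => W12S ℓ)

/-- The scaled gradient `∇_ε w = (∂₁ w, ε⁻¹ ∂₂ w) ∈ W^{1,2}(S; ℝ²)` of `w ∈ W^{2,2}(S)`. -/
def scaledGradient {ℓ : ℝ} (ε : ℝ) (w : W22S ℓ) : W12SVec ℓ :=
  WithLp.toLp 2 ![w.partialDeriv 0, ε⁻¹ • w.partialDeriv 1]

/-- `F ∈ L²(S)` is the function `(x₁, x₂) ↦ f x₁`. -/
def IsExtension {ℓ : ℝ} (f : L2 (I ℓ)) (F : L2 (S ℓ)) : Prop :=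
  ∀ᵐ x ∂(volume.restrict (S ℓ)), F x = f x.1

/-- `u ⇀ w` weakly in `W^{2,2}(S)`, where `w ∈ W^{2,2}(I)` is regarded as the function
`(x₁, x₂) ↦ w x₁` on `S`. -/
def DisplacementTendsto {α : Type*} {ℓ : ℝ} (u : α → W22S ℓ) (l : Filter α) (w : W22I ℓ) : Prop :=
  ∃ v : W22S ℓ, IsExtension w.toL2 v.toL2 ∧ WeakTendsto u l v

/-- `g ⇀ (w', ϑ)` weakly in `W^{1,2}(S; ℝ²)`, where `w'` and `ϑ` are regarded as functions on `S`
that do not depend on `x₂`. -/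
def GradientTendsto {α : Type*} {ℓ : ℝ} (g : α → W12SVec ℓ) (l : Filter α) (w : W22I ℓ)
    (ϑ : W12I ℓ) : Prop :=
  ∃ G : W12SVec ℓ, IsExtension (w.partialDeriv 0).toL2 (W12.toL2 (G 0)) ∧
    IsExtension ϑ.toL2 (W12.toL2 (G 1)) ∧ WeakTendsto g l G

end Strip

section Energies

/-- The space of real symmetric `2 × 2` matrices. -/
def Sym22 : Submodule ℝ (Matrix (Fin 2) (Fin 2) ℝ) where
  carrier := {M | M.IsSymm}
  zero_mem' := Matrix.isSymm_zero
  add_mem' := fun hA hB => hA.add hB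
  smul_mem' := fun c _ hA => hA.smul c

/-- The symmetric matrix with rows `(p, q)` and `(q, r)`. -/
def symMat (p q r : ℝ) : Sym22 :=
  ⟨!![p, q; q, r], Matrix.IsSymm.ext fun i j => by fin_cases i <;> fin_cases j <;> rfl⟩

/-- `Q₁(κ, τ)`, the minimum over `γ` of `Q₂` on the symmetric matrix with rows
`(κ, τ)` and `(τ, γ)`. -/
def Q₁ (Q₂ : QuadraticForm ℝ Sym22) (κ τ : ℝ) : ℝ := ⨅ γ : ℝ, Q₂ (symMat κ τ γ)

/-- The infimum in the definition of `Q₁` is a minimum. -/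
theorem isLeast_Q₁ {Q₂ : QuadraticForm ℝ Sym22} (hQ₂ : Q₂.PosDef) (κ τ : ℝ) :
    IsLeast (Set.range fun γ : ℝ => Q₂ (symMat κ τ γ)) (Q₁ Q₂ κ τ) := by
  set A := symMat κ τ 0
  set B := symMat 0 0 1
  have hB : 0 < Q₂ B := by
    apply hQ₂
    intro h
    have := congrArg (fun M : Sym22 => M.1 1 1) h
    simp [B, symMat] at this
  have hexp : ∀ γ : ℝ, Q₂ (symMat κ τ γ) = Q₂ A + γ * QuadraticMap.polar Q₂ A B
      + γ * γ * Q₂ B := by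
    intro γ
    have : symMat κ τ γ = A + γ • B := by
      apply Subtype.ext
      ext i j
      fin_cases i <;> fin_cases j <;> simp [A, B, symMat]
    have h2 := QuadraticMap.polar_smul_right Q₂ γ A B
    have h3 := QuadraticMap.map_smul Q₂ γ B
    simp only [smul_eq_mul] at h2 h3
    rw [this, QuadraticMap.map_add Q₂, h2, h3]
    ring
  set c := QuadraticMap.polar Q₂ A B
  have hmin : IsLeast (Set.range fun γ : ℝ => Q₂ (symMat κ τ γ))
      (Q₂ (symMat κ τ (-c / (2 * Q₂ B)))) := by
    refine ⟨⟨_, rfl⟩, ?_⟩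
    rintro _ ⟨γ, rfl⟩
    simp only [hexp]
    have h : Q₂ A + γ * c + γ * γ * Q₂ B
        - (Q₂ A + -c / (2 * Q₂ B) * c + -c / (2 * Q₂ B) * (-c / (2 * Q₂ B)) * Q₂ B)
        = Q₂ B * (γ + c / (2 * Q₂ B)) ^ 2 := by
      field_simp
      ring
    have := mul_nonneg hB.le (sq_nonneg (γ + c / (2 * Q₂ B)))
    linarith
  have heq : Q₁ Q₂ κ τ = Q₂ (symMat κ τ (-c / (2 * Q₂ B))) := hmin.csInf_eq
  rw [heq]
  exact hmin

/-- The scaled Hessian `∇²_ε w`, with entries `∂²₁₁ w`, `ε⁻¹ ∂²₁₂ w` (twice), `ε⁻² ∂²₂₂ w`;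
`(w.partialDeriv i).partialDeriv j` is `∂_j ∂_i w`, and `∂₁∂₂ w = ∂₂∂₁ w` almost everywhere, so
that either can be used off the diagonal. -/
def scaledHessian {ℓ : ℝ} (ε : ℝ) (w : W22S ℓ) (x : ℝ × ℝ) : Sym22 :=
  symMat ((w.partialDeriv 0).partialDeriv 0 x) (ε⁻¹ * (w.partialDeriv 1).partialDeriv 0 x)
    ((ε ^ 2)⁻¹ * (w.partialDeriv 1).partialDeriv 1 x)

/-- `J^ben_ε(w) = (1/24) ∫_S Q₂(∇²_ε w) dx`. -/
def Jben (Q₂ : QuadraticForm ℝ Sym22) {ℓ : ℝ} (ε : ℝ) (w : W22S ℓ) : ℝ :=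
  1 / 24 * ∫ x in S ℓ, Q₂ (scaledHessian ε w x)

/-- `J^LvK(w, ϑ) = (1/24) ∫_I Q₁(w'', ϑ') dx₁`. -/
def JLvK (Q₂ : QuadraticForm ℝ Sym22) {ℓ : ℝ} (w : W22I ℓ) (ϑ : W12I ℓ) : ℝ :=
  1 / 24 * ∫ t in I ℓ, Q₁ Q₂ ((w.partialDeriv 0).partialDeriv 0 t) (ϑ.partialDeriv 0 t)

end Energies

end

end NarrowStrip

namespace NarrowStrip

noncomputable section

/-! ### Weak and strong convergence in normed spaces. -/

section Convergence

variable {α V : Type*} [NormedAddCommGroup V] [NormedSpace ℝ V]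

/-! Lower bound: discarding the (2,2) entry of the scaled Hessian replaces `Q₂` by the smaller `Q₁`.
The other entries are `∂₁` of the two components of the scaled gradient, so they converge weakly in
`L²` to `w''` and `ϑ'`. Since `Q₁` is a nonnegative quadratic form, it lies above its tangent plane
at `(w'', ϑ')`; the integrated tangent plane (`integral_tangent_le`) is affine in the weakly
convergent entries, and its limit is exactly the energy `JLvK`.

Recovery: the minimizer in `Q₁` is the linear function `γ = optA κ + optB τ`. With `γ_ε ≈ optA w'' +
optB ϑ'` and `θ_ε ≈ ϑ`, put `w_ε = w + ε x₂ θ_ε + ε² (x₂²/2 - 1/24) γ_ε`. Its scaled Hessian has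
entries `w'' + ε x₂ θ_ε'' + ε² (x₂²/2 - 1/24) γ_ε''`, `θ_ε' + ε x₂ γ_ε'` and `γ_ε`. As `ϑ'` and the
optimal `γ` are only in `L²`, they are approximated by test functions whose derivatives blow up more
slowly than `1/ε` (`exists_test_family`); `θ_ε` is the zero-mean primitive of the first approximant
and converges to `ϑ` by `poincare`. All entries then converge strongly in `L²`, so the energies
converge and the required weak convergences hold even strongly. -/

theorem WeakTendsto.of_tendsto {u : α → V} {l : Filter α} {v : V} (h : Tendsto u l (𝓝 v)) :
    WeakTendsto u l v :=
  ((toWeakSpaceCLM ℝ V).continuous.tendsto v).comp h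

theorem WeakTendsto.eval {u : α → V} {l : Filter α} {v : V} (h : WeakTendsto u l v)
    (f : V →L[ℝ] ℝ) : Tendsto (fun a => f (u a)) l (𝓝 (f v)) :=
  ((WeakBilin.eval_continuous (topDualPairing ℝ V).flip f).tendsto _).comp h

end Convergence

/-! ### Inner products in `L²`. -/

section Integrals

variable {X : Type*} [MeasurableSpace X] {μ : Measure X}

theorem integrable_mul_Lp (f g : Lp ℝ 2 μ) : Integrable (fun x => f x * g x) μ :=
  (Lp.memLp f).integrable_mul (Lp.memLp g)

theorem inner_Lp_eq (f g : Lp ℝ 2 μ) : inner ℝ f g = ∫ x, f x * g x ∂μ := by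
  rw [MeasureTheory.L2.inner_def]
  simp only [RCLike.inner_apply, conj_trivial, mul_comm]

theorem integral_Lp_eq_inner [IsFiniteMeasure μ] (f : Lp ℝ 2 μ) :
    ∫ x, f x ∂μ = inner ℝ (Lp.const 2 μ (1 : ℝ)) f := by
  rw [inner_Lp_eq]
  apply integral_congr_ae
  filter_upwards [Lp.coeFn_const (p := 2) μ (1 : ℝ)] with x hx
  rw [hx, Function.const_apply, one_mul]

end Integrals

/-! ### Sobolev spaces: convergence and uniqueness of weak derivatives. -/

section SobolevSpaces

set_option linter.unusedSectionVars false

variable {E : Type*} [NormedAddCommGroup E] [NormedSpace ℝ E] [MeasureSpace E]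
  [BorelSpace E] [IsFiniteMeasureOnCompacts (volume : Measure E)]
  {ι : Type*} [Fintype ι] {b : ι → E} {Ω : Set E}

/-- The weak partial derivative as a continuous linear map on `W^{1,2}(Ω)`. -/
def W12.partialDerivL (b : ι → E) (Ω : Set E) (i : ι) : W12 b Ω →L[ℝ] L2 Ω :=
  (PiLp.proj 2 (fun _ : ι => L2 Ω) i : PiLp 2 (fun _ : ι => L2 Ω) →L[ℝ] L2 Ω) ∘L
    (WithLp.sndL 2 ℝ (L2 Ω) (PiLp 2 (fun _ : ι => L2 Ω))) ∘L (W12Submodule b Ω).subtypeL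

theorem W12.partialDerivL_apply (i : ι) (u : W12 b Ω) :
    W12.partialDerivL b Ω i u = u.partialDeriv i := rfl

/-- The element of `W^{1,2}(Ω)` with function `f` and weak partial derivatives `g i`. -/
def W12.mk (f : L2 Ω) (g : ι → L2 Ω) (h : ∀ i, IsWeakDeriv Ω (b i) f (g i)) : W12 b Ω :=
  ⟨WithLp.toLp 2 (f, WithLp.toLp 2 g), h⟩

theorem W12.isWeakDeriv (u : W12 b Ω) (i : ι) :
    IsWeakDeriv Ω (b i) u.toL2 (u.partialDeriv i) := u.2 i

theorem W22.isWeakDeriv (u : W22 b Ω) (i : ι) :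
    IsWeakDeriv Ω (b i) u.toL2 (u.partialDeriv i).toL2 := u.2 i

/-- The element of `W^{2,2}(Ω)` with function `f` and weak partial derivatives `g i`. -/
def W22.mk (f : L2 Ω) (g : ι → W12 b Ω) (h : ∀ i, IsWeakDeriv Ω (b i) f (g i).toL2) : W22 b Ω :=
  ⟨WithLp.toLp 2 (f, WithLp.toLp 2 g), h⟩

variable {α : Type*} {l : Filter α}

theorem W12.tendsto {u : α → W12 b Ω} {v : W12 b Ω}
    (h : Tendsto (fun a => (u a).toL2) l (𝓝 v.toL2))
    (h' : ∀ i, Tendsto (fun a => (u a).partialDeriv i) l (𝓝 (v.partialDeriv i))) :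
    Tendsto u l (𝓝 v) := by
  rw [tendsto_subtype_rng]
  have h2 : Tendsto (fun a i => (u a).partialDeriv i) l (𝓝 (fun i => v.partialDeriv i)) :=
    tendsto_pi_nhds.2 h'
  have h3 := ((PiLp.continuous_toLp 2 (fun _ : ι => L2 Ω)).tendsto _).comp h2
  exact ((WithLp.prod_continuous_toLp 2 _ _).tendsto _).comp (h.prodMk_nhds h3)

theorem W22.tendsto {u : α → W22 b Ω} {v : W22 b Ω}
    (h : Tendsto (fun a => (u a).toL2) l (𝓝 v.toL2))
    (h' : ∀ i, Tendsto (fun a => (u a).partialDeriv i) l (𝓝 (v.partialDeriv i))) :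
    Tendsto u l (𝓝 v) := by
  rw [tendsto_subtype_rng]
  have h2 : Tendsto (fun a i => (u a).partialDeriv i) l (𝓝 (fun i => v.partialDeriv i)) :=
    tendsto_pi_nhds.2 h'
  have h3 := ((PiLp.continuous_toLp 2 (fun _ : ι => W12 b Ω)).tendsto _).comp h2
  exact ((WithLp.prod_continuous_toLp 2 _ _).tendsto _).comp (h.prodMk_nhds h3)

set_option synthInstance.maxHeartbeats 200000 in
theorem W22.weakTendsto {u : α → W22 b Ω} {v : W22 b Ω}
    (h : Tendsto (fun a => (u a).toL2) l (𝓝 v.toL2))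
    (h' : ∀ i, Tendsto (fun a => (u a).partialDeriv i) l (𝓝 (v.partialDeriv i))) :
    WeakTendsto u l v :=
  WeakTendsto.of_tendsto (W22.tendsto h h')

theorem IsWeakDeriv.sub {e : E} {f g f' g' : L2 Ω} (h : IsWeakDeriv Ω e f g)
    (h' : IsWeakDeriv Ω e f' g') : IsWeakDeriv Ω e (f - f') (g - g') := by
  have := h.add (h'.smul (-1))
  rwa [neg_one_smul, neg_one_smul, ← sub_eq_add_neg, ← sub_eq_add_neg] at this

/-- A test function as an element of `L²(Ω)`. -/
def IsTestFunction.toL2 {φ : E → ℝ} (hφ : IsTestFunction Ω φ) : L2 Ω :=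
  ((hφ.smooth.continuous.memLp_of_hasCompactSupport (p := 2) (μ := volume)
    hφ.compact).restrict Ω).toLp φ

theorem IsTestFunction.coeFn_toL2 {φ : E → ℝ} (hφ : IsTestFunction Ω φ) :
    hφ.toL2 =ᵐ[volume.restrict Ω] φ := MemLp.coeFn_toLp _

theorem IsTestFunction.inner_toL2 {φ : E → ℝ} (hφ : IsTestFunction Ω φ) (f : L2 Ω) :
    inner ℝ f hφ.toL2 = ∫ x in Ω, f x * φ x := by
  rw [inner_Lp_eq]
  apply integral_congr_ae
  filter_upwards [hφ.coeFn_toL2] with x hx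
  rw [hx]

/-- The fundamental lemma of the calculus of variations; it gives both the uniqueness of weak
derivatives and the density of test functions. -/
theorem L2.eq_zero_of_test [FiniteDimensional ℝ E] (hΩ : IsOpen Ω) (f : L2 Ω)
    (h : ∀ φ : E → ℝ, IsTestFunction Ω φ → ∫ x in Ω, f x * φ x = 0) : f = 0 := by
  have key : ∀ᵐ x ∂(volume.restrict Ω), x ∈ Ω → f x = 0 := by
    apply hΩ.ae_eq_zero_of_integral_contDiff_smul_eq_zero
    · exact ((Lp.memLp f).locallyIntegrable (by norm_num)).locallyIntegrableOn Ω
    · intro φ h1 h2 h3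
      simpa only [smul_eq_mul, mul_comm] using h φ ⟨h1, h2, h3⟩
  rw [Lp.eq_zero_iff_ae_eq_zero]
  filter_upwards [key, ae_restrict_mem hΩ.measurableSet] with x h1 h2 using h1 h2

/-- Weak limits on the strip are prescribed only through their underlying functions; uniqueness then
identifies their derivatives. -/
theorem IsWeakDeriv.unique [FiniteDimensional ℝ E] (hΩ : IsOpen Ω) {e : E} {f g g' : L2 Ω}
    (h : IsWeakDeriv Ω e f g) (h' : IsWeakDeriv Ω e f g') : g = g' := by
  rw [← sub_eq_zero]
  apply L2.eq_zero_of_test hΩ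
  intro φ hφ
  have := h.sub h' φ hφ
  rw [sub_self] at this
  rw [← neg_eq_zero, ← this]
  apply integral_eq_zero_of_ae
  filter_upwards [Lp.coeFn_zero ℝ 2 (volume.restrict Ω)] with x hx
  simp only [hx, Pi.zero_apply, zero_mul]

end SobolevSpaces

/-! ### Algebra of `Q₁` and `Q₂`. -/

section QuadraticForms

variable (Q₂ : QuadraticForm ℝ Sym22)

/-- The coefficients of a quadratic form on symmetric matrices: the values on the basis matrices
`E₁ = symMat 1 0 0`, `E₂ = symMat 0 1 0`, `E₃ = symMat 0 0 1`, and the polar form between them. -/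
theorem quadraticForm_symMat (p q r : ℝ) :
    Q₂ (symMat p q r) = Q₂ (symMat 1 0 0) * p ^ 2 + Q₂ (symMat 0 1 0) * q ^ 2
      + Q₂ (symMat 0 0 1) * r ^ 2
      + QuadraticMap.polar Q₂ (symMat 1 0 0) (symMat 0 1 0) * (p * q)
      + QuadraticMap.polar Q₂ (symMat 1 0 0) (symMat 0 0 1) * (p * r)
      + QuadraticMap.polar Q₂ (symMat 0 1 0) (symMat 0 0 1) * (q * r) := by
  have hs : symMat p q r = (p • symMat 1 0 0 + q • symMat 0 1 0) + r • symMat 0 0 1 := by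
    apply Subtype.ext
    ext i j
    fin_cases i <;> fin_cases j <;> simp [symMat]
  rw [hs, QuadraticMap.map_add Q₂, QuadraticMap.map_add Q₂, QuadraticMap.polar_add_left,
    QuadraticMap.map_smul, QuadraticMap.map_smul, QuadraticMap.map_smul]
  simp only [QuadraticMap.polar_smul_left, QuadraticMap.polar_smul_right, smul_eq_mul]
  ring

/-- The first coefficient of the linear map `(κ, τ) ↦ γ` giving the minimizer in `Q₁`. -/
def optA : ℝ := -QuadraticMap.polar Q₂ (symMat 1 0 0) (symMat 0 0 1) / (2 * Q₂ (symMat 0 0 1))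

/-- The second coefficient of the linear map `(κ, τ) ↦ γ` giving the minimizer in `Q₁`. -/
def optB : ℝ := -QuadraticMap.polar Q₂ (symMat 0 1 0) (symMat 0 0 1) / (2 * Q₂ (symMat 0 0 1))

variable {Q₂}

theorem quadraticForm_symMat_pos (hQ₂ : Q₂.PosDef) : 0 < Q₂ (symMat 0 0 1) := by
  apply hQ₂
  intro h
  have := congrArg (fun M : Sym22 => M.1 1 1) h
  simp [symMat] at this

/-- Completing the square in the last entry. -/
theorem quadraticForm_opt_le (hQ₂ : Q₂.PosDef) (p q r : ℝ) :
    Q₂ (symMat p q (optA Q₂ * p + optB Q₂ * q)) ≤ Q₂ (symMat p q r) := by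
  have hC := quadraticForm_symMat_pos hQ₂
  have key : Q₂ (symMat p q r) - Q₂ (symMat p q (optA Q₂ * p + optB Q₂ * q))
      = Q₂ (symMat 0 0 1) * (r - (optA Q₂ * p + optB Q₂ * q)) ^ 2 := by
    rw [quadraticForm_symMat Q₂ p q r, quadraticForm_symMat Q₂ p q (_ + _), optA, optB]
    field_simp
    ring
  have := mul_nonneg hC.le (sq_nonneg (r - (optA Q₂ * p + optB Q₂ * q)))
  linarith

theorem Q₁_eq (hQ₂ : Q₂.PosDef) (κ τ : ℝ) :
    Q₁ Q₂ κ τ = Q₂ (symMat κ τ (optA Q₂ * κ + optB Q₂ * τ)) := by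
  have h := isLeast_Q₁ hQ₂ κ τ
  obtain ⟨γ, hγ⟩ := h.1
  apply le_antisymm (h.2 ⟨_, rfl⟩)
  rw [← hγ]
  exact quadraticForm_opt_le hQ₂ κ τ γ

theorem Q₁_le (hQ₂ : Q₂.PosDef) (κ τ γ : ℝ) : Q₁ Q₂ κ τ ≤ Q₂ (symMat κ τ γ) :=
  (isLeast_Q₁ hQ₂ κ τ).2 ⟨γ, rfl⟩

variable (Q₂) in
/-- The `κ²` coefficient of `Q₁`. -/
def coeffA : ℝ := Q₁ Q₂ 1 0

variable (Q₂) in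
/-- The `τ²` coefficient of `Q₁`. -/
def coeffB : ℝ := Q₁ Q₂ 0 1

variable (Q₂) in
/-- Half the `κ τ` coefficient of `Q₁`. -/
def coeffC : ℝ := (Q₁ Q₂ 1 1 - Q₁ Q₂ 1 0 - Q₁ Q₂ 0 1) / 2

/-- By `Q₁_eq`, `Q₁` is `Q₂` composed with a linear map, hence a quadratic form, so its values at
`(1,0)`, `(0,1)` and `(1,1)` determine it. The mixed term is split in two to match the polarized
form in `Q₁_tangent_le`. -/
theorem Q₁_eq_coeff (hQ₂ : Q₂.PosDef) (κ τ : ℝ) :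
    Q₁ Q₂ κ τ = coeffA Q₂ * (κ * κ) + coeffC Q₂ * (κ * τ) + coeffC Q₂ * (τ * κ)
      + coeffB Q₂ * (τ * τ) := by
  simp only [coeffA, coeffB, coeffC, Q₁_eq hQ₂]
  rw [quadraticForm_symMat Q₂ κ τ, quadraticForm_symMat Q₂ 1 0 (_ + _),
    quadraticForm_symMat Q₂ 0 1 (_ + _), quadraticForm_symMat Q₂ 1 1 (_ + _)]
  ring

theorem Q₁_nonneg (hQ₂ : Q₂.PosDef) (κ τ : ℝ) : 0 ≤ Q₁ Q₂ κ τ := by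
  rw [Q₁_eq hQ₂]
  exact hQ₂.nonneg _

/-- A quadratic form lies above its tangent planes. -/
theorem Q₁_tangent_le (hQ₂ : Q₂.PosDef) (κ τ κ' τ' : ℝ) :
    2 * (coeffA Q₂ * (κ * κ') + coeffC Q₂ * (κ * τ') + coeffC Q₂ * (τ * κ')
      + coeffB Q₂ * (τ * τ')) - Q₁ Q₂ κ τ ≤ Q₁ Q₂ κ' τ' := by
  -- The gap between the form and its tangent plane is the form evaluated at the difference.
  have h := Q₁_nonneg hQ₂ (κ - κ') (τ - τ')
  rw [Q₁_eq_coeff hQ₂] at h ⊢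
  rw [Q₁_eq_coeff hQ₂ κ' τ']
  linarith

end QuadraticForms

/-! ### Energies as combinations of `L²` inner products. -/

section Integrals

variable {X : Type*} [MeasurableSpace X] {μ : Measure X}

theorem integral_const_mul_mul_Lp (c : ℝ) (f g : Lp ℝ 2 μ) :
    Integrable (fun x => c * (f x * g x)) μ ∧
      ∫ x, c * (f x * g x) ∂μ = c * inner ℝ f g :=
  ⟨(integrable_mul_Lp f g).const_mul c, by rw [integral_const_mul, inner_Lp_eq]⟩

theorem integral_add_of_eq {F G : X → ℝ} {a b : ℝ} (hF : Integrable F μ ∧ ∫ x, F x ∂μ = a)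
    (hG : Integrable G μ ∧ ∫ x, G x ∂μ = b) :
    Integrable (fun x => F x + G x) μ ∧ ∫ x, (F x + G x) ∂μ = a + b :=
  ⟨hF.1.add hG.1, by rw [integral_add hF.1 hG.1, hF.2, hG.2]⟩

variable (Q₂ : QuadraticForm ℝ Sym22)

/-- Expressed through inner products, the energy inherits its strong continuity from that of the
inner product. -/
theorem integral_quadraticForm (p q r : Lp ℝ 2 μ) :
    Integrable (fun x => Q₂ (symMat (p x) (q x) (r x))) μ ∧
    ∫ x, Q₂ (symMat (p x) (q x) (r x)) ∂μ =
      Q₂ (symMat 1 0 0) * inner ℝ p p + Q₂ (symMat 0 1 0) * inner ℝ q q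
      + Q₂ (symMat 0 0 1) * inner ℝ r r
      + QuadraticMap.polar Q₂ (symMat 1 0 0) (symMat 0 1 0) * inner ℝ p q
      + QuadraticMap.polar Q₂ (symMat 1 0 0) (symMat 0 0 1) * inner ℝ p r
      + QuadraticMap.polar Q₂ (symMat 0 1 0) (symMat 0 0 1) * inner ℝ q r := by
  have hs := fun x => quadraticForm_symMat Q₂ (p x) (q x) (r x)
  simp only [pow_two] at hs
  rw [funext hs]
  have h := @integral_const_mul_mul_Lp X _ μ
  exact integral_add_of_eq (integral_add_of_eq (integral_add_of_eq (integral_add_of_eq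
    (integral_add_of_eq (h _ p p) (h _ q q)) (h _ r r)) (h _ p q)) (h _ p r)) (h _ q r)

/-- The energy is continuous for the strong convergence of the entries. -/
theorem tendsto_integral_quadraticForm {α : Type*} {l : Filter α} {p q r : α → Lp ℝ 2 μ}
    {p₀ q₀ r₀ : Lp ℝ 2 μ} (hp : Tendsto p l (𝓝 p₀)) (hq : Tendsto q l (𝓝 q₀))
    (hr : Tendsto r l (𝓝 r₀)) :
    Tendsto (fun a => ∫ x, Q₂ (symMat (p a x) (q a x) (r a x)) ∂μ) l
      (𝓝 (∫ x, Q₂ (symMat (p₀ x) (q₀ x) (r₀ x)) ∂μ)) := by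
  simp only [(integral_quadraticForm Q₂ _ _ _).2]
  exact ((((((hp.inner hp).const_mul _).add ((hq.inner hq).const_mul _)).add
    ((hr.inner hr).const_mul _)).add ((hp.inner hq).const_mul _)).add
    ((hp.inner hr).const_mul _)).add ((hq.inner hr).const_mul _)

variable {Q₂}

theorem integrable_Q₁ (hQ₂ : Q₂.PosDef) (p q : Lp ℝ 2 μ) :
    Integrable (fun x => Q₁ Q₂ (p x) (q x)) μ := by
  simp only [Q₁_eq_coeff hQ₂]
  have := @integrable_mul_Lp X _ μ
  exact ((((this p p).const_mul _).add ((this p q).const_mul _)).add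
    ((this q p).const_mul _)).add ((this q q).const_mul _)

/-- The integral of the polar form of `Q₁`, in terms of inner products. -/
theorem integral_coeff (p q p' q' : Lp ℝ 2 μ) :
    Integrable (fun x => coeffA Q₂ * (p x * p' x) + coeffC Q₂ * (p x * q' x)
        + coeffC Q₂ * (q x * p' x) + coeffB Q₂ * (q x * q' x)) μ ∧
    ∫ x, (coeffA Q₂ * (p x * p' x) + coeffC Q₂ * (p x * q' x) + coeffC Q₂ * (q x * p' x)
      + coeffB Q₂ * (q x * q' x)) ∂μ = coeffA Q₂ * inner ℝ p p' + coeffC Q₂ * inner ℝ p q'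
      + coeffC Q₂ * inner ℝ q p' + coeffB Q₂ * inner ℝ q q' := by
  have h := @integral_const_mul_mul_Lp X _ μ
  exact integral_add_of_eq (integral_add_of_eq (integral_add_of_eq (h _ p p') (h _ p q'))
    (h _ q p')) (h _ q q')

theorem integral_Q₁ (hQ₂ : Q₂.PosDef) (p q : Lp ℝ 2 μ) :
    ∫ x, Q₁ Q₂ (p x) (q x) ∂μ = coeffA Q₂ * inner ℝ p p + coeffC Q₂ * inner ℝ p q
      + coeffC Q₂ * inner ℝ q p + coeffB Q₂ * inner ℝ q q := by
  simp only [Q₁_eq_coeff hQ₂]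
  exact (integral_coeff p q p q).2

/-- The integrated tangent-plane inequality. -/
theorem integral_tangent_le (hQ₂ : Q₂.PosDef) (p q p' q' r' : Lp ℝ 2 μ) :
    2 * (coeffA Q₂ * inner ℝ p p' + coeffC Q₂ * inner ℝ p q'
      + coeffC Q₂ * inner ℝ q p' + coeffB Q₂ * inner ℝ q q') - ∫ x, Q₁ Q₂ (p x) (q x) ∂μ
      ≤ ∫ x, Q₂ (symMat (p' x) (q' x) (r' x)) ∂μ := by
  obtain ⟨hi, he⟩ := integral_coeff (Q₂ := Q₂) p q p' q'
  rw [← he, ← integral_const_mul, ← integral_sub (hi.const_mul 2) (integrable_Q₁ hQ₂ p q)]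
  apply integral_mono ((hi.const_mul 2).sub (integrable_Q₁ hQ₂ p q))
    (integral_quadraticForm Q₂ p' q' r').1
  intro x
  exact (Q₁_tangent_le hQ₂ _ _ _ _).trans (Q₁_le hQ₂ _ _ _)

end Integrals

/-! ### Products `f(x₁) p(x₂)` on the strip and their weak derivatives. -/

section Tensor

theorem isOpen_I (ℓ : ℝ) : IsOpen (I ℓ) := isOpen_Ioo

theorem isOpen_S (ℓ : ℝ) : IsOpen (S ℓ) := (isOpen_I ℓ).prod isOpen_Ioo

/-- The cross section `(-1/2, 1/2)` of the rescaled strip. -/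
def crossSection : Set ℝ := Set.Ioo (-1 / 2) (1 / 2)

/-- The unit width is what makes integrals over the strip and over the interval agree for functions
of `x₁`, with no extra factor. -/
instance : IsProbabilityMeasure (volume.restrict crossSection) :=
  ⟨by rw [Measure.restrict_apply_univ, crossSection, Real.volume_Ioo]; norm_num⟩

instance (ℓ : ℝ) : IsFiniteMeasure (volume.restrict (I ℓ)) :=
  ⟨by rw [Measure.restrict_apply_univ, I, Real.volume_Ioo]; exact ENNReal.ofReal_lt_top⟩

theorem restrict_S (ℓ : ℝ) : (volume : Measure (ℝ × ℝ)).restrict (S ℓ) =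
    (volume.restrict (I ℓ)).prod (volume.restrict crossSection) :=
  (Measure.prod_restrict (μ := (volume : Measure ℝ)) (ν := (volume : Measure ℝ)) _ _).symm

instance (ℓ : ℝ) : IsFiniteMeasure ((volume : Measure (ℝ × ℝ)).restrict (S ℓ)) := by
  rw [restrict_S]; infer_instance

theorem measurePreserving_fst_S (ℓ : ℝ) :
    MeasurePreserving Prod.fst ((volume : Measure (ℝ × ℝ)).restrict (S ℓ))
      (volume.restrict (I ℓ)) := by
  rw [restrict_S]; exact measurePreserving_fst

theorem exists_bound_crossSection (p : Polynomial ℝ) :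
    ∃ M : ℝ, ∀ y ∈ crossSection, ‖p.eval y‖ ≤ M := by
  obtain ⟨M, hM⟩ := isCompact_Icc.exists_bound_of_continuousOn
    (f := fun y => p.eval y) (s := Set.Icc (-1 / 2 : ℝ) (1 / 2)) p.continuous.continuousOn
  exact ⟨M, fun y hy => hM y (Set.Ioo_subset_Icc_self hy)⟩

variable {ℓ : ℝ}

theorem coeFn_comp_fst (f : L2 (I ℓ)) :
    Lp.compMeasurePreserving Prod.fst (measurePreserving_fst_S ℓ) f
      =ᵐ[volume.restrict (S ℓ)] fun x => f x.1 :=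
  Lp.coeFn_compMeasurePreserving f (measurePreserving_fst_S ℓ)

theorem tensor_bound {p : Polynomial ℝ} {M : ℝ} (hM : ∀ y ∈ crossSection, ‖p.eval y‖ ≤ M)
    (f : L2 (I ℓ)) : ∀ᵐ x ∂(volume.restrict (S ℓ)), ‖f x.1 * p.eval x.2‖ ≤
      M * ‖Lp.compMeasurePreserving Prod.fst (measurePreserving_fst_S ℓ) f x‖ := by
  filter_upwards [coeFn_comp_fst f, ae_restrict_mem (isOpen_S ℓ).measurableSet] with x hx hx'
  rw [hx, norm_mul, mul_comm]
  exact mul_le_mul_of_nonneg_right (hM _ hx'.2) (norm_nonneg _)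

theorem memLp_tensor (f : L2 (I ℓ)) (p : Polynomial ℝ) :
    MemLp (fun x : ℝ × ℝ => f x.1 * p.eval x.2) 2 (volume.restrict (S ℓ)) := by
  obtain ⟨M, hM⟩ := exists_bound_crossSection p
  refine (Lp.memLp (Lp.compMeasurePreserving Prod.fst (measurePreserving_fst_S ℓ) f)).of_le_mul
    ?_ (tensor_bound hM f)
  exact ((Lp.aestronglyMeasurable f).comp_measurePreserving (measurePreserving_fst_S ℓ)).mul
    (p.continuous.comp continuous_snd).aestronglyMeasurable

/-- The function `(x₁, x₂) ↦ f x₁ * p x₂` on the strip. -/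
def tensorLp (f : L2 (I ℓ)) (p : Polynomial ℝ) : L2 (S ℓ) := (memLp_tensor f p).toLp _

theorem coeFn_tensorLp (f : L2 (I ℓ)) (p : Polynomial ℝ) :
    tensorLp f p =ᵐ[volume.restrict (S ℓ)] fun x => f x.1 * p.eval x.2 := MemLp.coeFn_toLp _

theorem ae_comp_fst {P : ℝ → Prop} (h : ∀ᵐ t ∂(volume.restrict (I ℓ)), P t) :
    ∀ᵐ x ∂((volume : Measure (ℝ × ℝ)).restrict (S ℓ)), P x.1 :=
  (measurePreserving_fst_S ℓ).quasiMeasurePreserving.ae h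

variable (ℓ) in
/-- Multiplication of a function of `x₁` by a fixed polynomial in `x₂`. -/
def tensor (p : Polynomial ℝ) : L2 (I ℓ) →L[ℝ] L2 (S ℓ) :=
  LinearMap.mkContinuousOfExistsBound
    { toFun := fun f => tensorLp f p
      map_add' := by
        intro f g
        apply Lp.ext
        filter_upwards [coeFn_tensorLp (f + g) p, coeFn_tensorLp f p, coeFn_tensorLp g p,
          Lp.coeFn_add (tensorLp f p) (tensorLp g p), ae_comp_fst (Lp.coeFn_add f g)]
          with x h1 h2 h3 h4 h5
        rw [h4, Pi.add_apply, h1, h2, h3, h5, Pi.add_apply, add_mul]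
      map_smul' := by
        intro c f
        apply Lp.ext
        filter_upwards [coeFn_tensorLp (c • f) p, coeFn_tensorLp f p,
          Lp.coeFn_smul c (tensorLp f p), ae_comp_fst (Lp.coeFn_smul c f)] with x h1 h2 h3 h4
        rw [RingHom.id_apply, h3, Pi.smul_apply, h1, h2, h4, Pi.smul_apply, smul_eq_mul,
          smul_eq_mul, mul_assoc] }
    (by
      obtain ⟨M, hM⟩ := exists_bound_crossSection p
      refine ⟨M, fun f => ?_⟩
      rw [← Lp.norm_compMeasurePreserving f (measurePreserving_fst_S ℓ)]
      apply Lp.norm_le_mul_norm_of_ae_le_mul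
      filter_upwards [coeFn_tensorLp f p, tensor_bound hM f] with x h1 h2
      change ‖tensorLp f p x‖ ≤ _
      rw [h1]
      exact h2)

theorem coeFn_tensor (p : Polynomial ℝ) (f : L2 (I ℓ)) :
    tensor ℓ p f =ᵐ[volume.restrict (S ℓ)] fun x => f x.1 * p.eval x.2 := coeFn_tensorLp f p

theorem tensor_zero_left (f : L2 (I ℓ)) : tensor ℓ 0 f = 0 := by
  apply Lp.ext
  filter_upwards [coeFn_tensor 0 f, Lp.coeFn_zero ℝ 2 (volume.restrict (S ℓ))] with x h1 h2
  rw [h1, h2]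
  simp

theorem isExtension_tensor_one (f : L2 (I ℓ)) : IsExtension f (tensor ℓ 1 f) := by
  filter_upwards [coeFn_tensor 1 f] with x hx
  rw [hx, Polynomial.eval_one, mul_one]

theorem IsExtension.eq_tensor {f : L2 (I ℓ)} {F : L2 (S ℓ)} (h : IsExtension f F) :
    F = tensor ℓ 1 f := by
  apply Lp.ext
  filter_upwards [h, isExtension_tensor_one f] with x h1 h2
  rw [h1, h2]

theorem integral_tensor (p : Polynomial ℝ) (f : L2 (I ℓ)) :
    ∫ x in S ℓ, tensor ℓ p f x =
      (∫ t in I ℓ, f t) * ∫ y in crossSection, p.eval y := by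
  rw [integral_congr_ae (coeFn_tensor p f), restrict_S]
  exact integral_prod_mul (fun t => f t) (fun y => p.eval y)

theorem integral_comp_fst (h : ℝ → ℝ) :
    ∫ x in S ℓ, h x.1 = ∫ t in I ℓ, h t := by
  rw [restrict_S]
  simpa using integral_prod_mul (μ := volume.restrict (I ℓ))
    (ν := volume.restrict crossSection) h (fun _ => (1 : ℝ))

/-! ### Slices of test functions on the strip -/

theorem isTestFunction_of_slice {φ : ℝ × ℝ → ℝ} {A B : Set ℝ} (hφ : IsTestFunction (A ×ˢ B) φ)
    (y : ℝ) : IsTestFunction A (fun t => φ (t, y)) := by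
  have hK : IsCompact (Prod.fst '' tsupport φ) := hφ.compact.isCompact.image continuous_fst
  have hsub : tsupport (fun t => φ (t, y)) ⊆ Prod.fst '' tsupport φ := by
    apply closure_minimal _ hK.isClosed
    intro t ht
    exact ⟨(t, y), subset_tsupport φ ht, rfl⟩
  refine ⟨hφ.smooth.comp (contDiff_id.prodMk contDiff_const),
    HasCompactSupport.of_support_subset_isCompact hK ((subset_tsupport _).trans hsub), ?_⟩
  rintro t ht
  obtain ⟨x, hx, rfl⟩ := hsub ht
  exact (hφ.support_subset hx).1

theorem isTestFunction_of_slice' {φ : ℝ × ℝ → ℝ} {A B : Set ℝ} (hφ : IsTestFunction (A ×ˢ B) φ)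
    (t : ℝ) : IsTestFunction B (fun y => φ (t, y)) := by
  have hK : IsCompact (Prod.snd '' tsupport φ) := hφ.compact.isCompact.image continuous_snd
  have hsub : tsupport (fun y => φ (t, y)) ⊆ Prod.snd '' tsupport φ := by
    apply closure_minimal _ hK.isClosed
    intro y hy
    exact ⟨(t, y), subset_tsupport φ hy, rfl⟩
  refine ⟨hφ.smooth.comp (contDiff_const.prodMk contDiff_id),
    HasCompactSupport.of_support_subset_isCompact hK ((subset_tsupport _).trans hsub), ?_⟩
  rintro y hy
  obtain ⟨x, hx, rfl⟩ := hsub hy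
  exact (hφ.support_subset hx).2

theorem fderiv_slice {φ : ℝ × ℝ → ℝ} (hφ : ContDiff ℝ ∞ φ) (t y : ℝ) :
    fderiv ℝ φ (t, y) (1, 0) = fderiv ℝ (fun s => φ (s, y)) t 1 := by
  have h1 := (hφ.differentiable (by simp) (t, y)).hasFDerivAt
  have h2 : HasFDerivAt (fun s : ℝ => (s, y))
    ((ContinuousLinearMap.id ℝ ℝ).prod (0 : ℝ →L[ℝ] ℝ)) t :=
    (hasFDerivAt_id t).prodMk (hasFDerivAt_const y t)
  have h3 := h1.comp t h2
  rw [show (fun s => φ (s, y)) = φ ∘ fun s => (s, y) from rfl, h3.fderiv]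
  simp

theorem fderiv_slice' {φ : ℝ × ℝ → ℝ} (hφ : ContDiff ℝ ∞ φ) (t y : ℝ) :
    fderiv ℝ φ (t, y) (0, 1) = fderiv ℝ (fun s => φ (t, s)) y 1 := by
  have h1 := (hφ.differentiable (by simp) (t, y)).hasFDerivAt
  have h2 : HasFDerivAt (fun s : ℝ => (t, s))
    ((0 : ℝ →L[ℝ] ℝ).prod (ContinuousLinearMap.id ℝ ℝ)) y :=
    (hasFDerivAt_const t y).prodMk (hasFDerivAt_id y)
  have h3 := h1.comp y h2
  rw [show (fun s => φ (t, s)) = φ ∘ fun s => (t, s) from rfl, h3.fderiv]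
  simp

/-- Integration by parts against a test function. -/
theorem IsTestFunction.integral_mul_fderiv {A : Set ℝ} {φ : ℝ → ℝ} (hφ : IsTestFunction A φ)
    {h : ℝ → ℝ} (hh : ContDiff ℝ ∞ h) :
    ∫ x in A, h x * fderiv ℝ φ x 1 = - ∫ x in A, deriv h x * φ x := by
  have hz : ∀ x, x ∉ A → φ x = 0 := fun x hx =>
    image_eq_zero_of_notMem_tsupport fun h' => hx (hφ.support_subset h')
  have hz' : ∀ x, x ∉ A → deriv φ x = 0 := fun x hx =>
    image_eq_zero_of_notMem_tsupport fun h' => hx (hφ.support_subset (tsupport_deriv_subset h'))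
  simp only [fderiv_apply_one_eq_deriv]
  -- Both integrands vanish off `A`, so the integration by parts takes place on the whole line,
  -- without boundary terms.
  rw [setIntegral_eq_integral_of_forall_compl_eq_zero (fun x hx => by rw [hz' x hx, mul_zero]),
    setIntegral_eq_integral_of_forall_compl_eq_zero (fun x hx => by rw [hz x hx, mul_zero])]
  have hφ' := hφ.smooth.continuous_deriv (by simp)
  have hh' := hh.continuous_deriv (by simp)
  apply integral_mul_deriv_eq_deriv_mul_of_integrable
  · exact fun x _ => (hh.differentiable (by simp) x).hasDerivAt
  · exact fun x _ => (hφ.smooth.differentiable (by simp) x).hasDerivAt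
  · exact (hh.continuous.mul hφ').integrable_of_hasCompactSupport hφ.compact.deriv.mul_left
  · exact (hh'.mul hφ.smooth.continuous).integrable_of_hasCompactSupport hφ.compact.mul_left
  · exact (hh.continuous.mul hφ.smooth.continuous).integrable_of_hasCompactSupport
      hφ.compact.mul_left

/-! ### Weak derivatives of products -/

theorem setIntegral_tensor_mul (p : Polynomial ℝ) (f : L2 (I ℓ)) (ψ : ℝ × ℝ → ℝ) :
    ∫ x in S ℓ, tensor ℓ p f x * ψ x = ∫ x, f x.1 * p.eval x.2 * ψ x
      ∂((volume.restrict (I ℓ)).prod (volume.restrict crossSection)) := by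
  rw [← restrict_S]
  apply integral_congr_ae
  filter_upwards [coeFn_tensor p f] with x hx
  rw [hx]

theorem integrable_tensor_mul {p : Polynomial ℝ} {f : L2 (I ℓ)} {ψ : ℝ × ℝ → ℝ}
    (h : Integrable (fun x => tensor ℓ p f x * ψ x) (volume.restrict (S ℓ))) :
    Integrable (fun x : ℝ × ℝ => f x.1 * p.eval x.2 * ψ x)
      ((volume.restrict (I ℓ)).prod (volume.restrict crossSection)) := by
  rw [← restrict_S]
  apply h.congr
  filter_upwards [coeFn_tensor p f] with x hx
  rw [hx]

/-- By Fubini with `x₂` frozen: each slice of a test function on the strip is a test function on the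
interval, and `p x₂` is a constant factor. -/
theorem IsWeakDeriv.tensor_fst {f g : L2 (I ℓ)} (h : IsWeakDeriv (I ℓ) 1 f g)
    (p : Polynomial ℝ) : IsWeakDeriv (S ℓ) (e 0) (tensor ℓ p f) (tensor ℓ p g) := by
  intro φ hφ
  rw [setIntegral_tensor_mul, setIntegral_tensor_mul,
    integral_prod_symm _ (integrable_tensor_mul (hφ.integrable_mul_fderiv (e 0) _)),
    integral_prod_symm _ (integrable_tensor_mul (hφ.integrable_mul _)), ← integral_neg]
  congr 1
  ext y
  have h1 := h _ (isTestFunction_of_slice hφ y)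
  have h2 : ∀ (u : L2 (I ℓ)) (ψ : ℝ → ℝ), ∫ t in I ℓ, u t * p.eval y * ψ t =
      p.eval y * ∫ t in I ℓ, u t * ψ t := by
    intro u ψ
    rw [← integral_const_mul]
    congr 1
    ext t
    ring
  rw [h2 f, h2 g, ← mul_neg, ← h1]
  congr 2
  ext t
  rw [← fderiv_slice hφ.smooth]
  rfl

/-- With `x₁` frozen, `f x₁` is a constant factor, so only the smoothness of `p` matters. -/
theorem isWeakDeriv_tensor_snd (f : L2 (I ℓ)) (p : Polynomial ℝ) :
    IsWeakDeriv (S ℓ) (e 1) (tensor ℓ p f) (tensor ℓ (Polynomial.derivative p) f) := by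
  intro φ hφ
  rw [setIntegral_tensor_mul, setIntegral_tensor_mul,
    integral_prod _ (integrable_tensor_mul (hφ.integrable_mul_fderiv (e 1) _)),
    integral_prod _ (integrable_tensor_mul (hφ.integrable_mul _)), ← integral_neg]
  congr 1
  ext t
  have h1 := (isTestFunction_of_slice' hφ t).integral_mul_fderiv (h := fun y => p.eval y)
    (by simpa using p.contDiff_aeval (𝕜 := ℝ) ∞)
  simp only [mul_assoc, integral_const_mul]
  rw [← mul_neg]
  congr 1
  simp only [Polynomial.deriv] at h1
  rw [crossSection, ← h1]
  congr 1
  ext y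
  rw [← fderiv_slice' hφ.smooth]
  rfl

end Tensor

/-! ### Density in a hyperplane and diagonal selection. -/

section Abstract

variable {H : Type*} [NormedAddCommGroup H] [InnerProductSpace ℝ H]

/-- The intersection of a dense subspace with a closed hyperplane is dense in the hyperplane. -/
theorem mem_closure_of_inner_eq_zero {T : Submodule ℝ H} {u v : H} (hu : u ∈ closure (T : Set H))
    (huv : inner ℝ v u = 0) : u ∈ closure {x : H | x ∈ T ∧ inner ℝ v x = 0} := by
  by_cases h : ∀ t ∈ T, inner ℝ v t = 0
  · exact closure_mono (fun t ht => (⟨ht, h t ht⟩ : t ∈ T ∧ inner ℝ v t = 0)) hu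
  · push Not at h
    obtain ⟨η, hη, hvη⟩ := h
    -- The projection onto the hyperplane along `η ∈ T` preserves `T` and fixes `u`.
    have hP : Continuous fun x : H => x - (inner ℝ v x / inner ℝ v η) • η := by fun_prop
    have := map_mem_closure hP hu (t := {x : H | x ∈ T ∧ inner ℝ v x = 0}) (by
      intro x hx
      refine ⟨T.sub_mem hx (T.smul_mem _ hη), ?_⟩
      rw [inner_sub_right, inner_smul_right, div_mul_cancel₀ _ hvη, sub_self])
    simpa [huv] using this

/-- A diagonal selection: approximants may be chosen so that a prescribed cost, multiplied by the
parameter, still vanishes. -/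
theorem exists_tendsto_cost {D : Type*} (a N : D → ℝ) (ha : ∀ d, 0 ≤ a d) (hN : ∀ d, 0 ≤ N d)
    (h : ∀ η > 0, ∃ d, a d < η) :
    ∃ d : ℝ → D, Tendsto (fun ε => a (d ε) + ε * N (d ε)) (𝓝[>] 0) (𝓝 0) := by
  obtain ⟨d₀, -⟩ := h 1 one_pos
  have hne : Nonempty D := ⟨d₀⟩
  -- For each `ε` take a minimizer of the penalized cost, up to an error `ε`.
  have hex : ∀ ε : ℝ, ∃ d, 0 < ε → a d + ε * N d < (⨅ d, (a d + ε * N d)) + ε := by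
    intro ε
    by_cases hε : 0 < ε
    · obtain ⟨d, hd⟩ := exists_lt_of_ciInf_lt (lt_add_of_pos_right (⨅ d, (a d + ε * N d)) hε)
      exact ⟨d, fun _ => hd⟩
    · exact ⟨d₀, fun h => absurd h hε⟩
  choose d hd using hex
  refine ⟨d, ?_⟩
  rw [Metric.tendsto_nhds]
  intro η hη
  obtain ⟨d₁, hd₁⟩ := h (η / 3) (by positivity)
  -- The competitor `d₁` costs less than `η / 3 + ε N d₁`; for small `ε`, the penalty and the
  -- minimization error each stay below `η / 3`. The `+ 1` avoids dividing by zero.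
  have hpos : 0 < η / 3 / (N d₁ + 1) := div_pos (by positivity) (by linarith [hN d₁])
  filter_upwards [Ioo_mem_nhdsGT (lt_min (show 0 < η / 3 by positivity) hpos)] with ε hε
  obtain ⟨h0, hlt⟩ := hε
  have h1 := hlt.trans_le (min_le_left _ _)
  have h2 := hlt.trans_le (min_le_right _ _)
  rw [lt_div_iff₀ (by linarith [hN d₁])] at h2
  have hnn : ∀ d, 0 ≤ a d + ε * N d := fun d => add_nonneg (ha d) (mul_nonneg h0.le (hN d))
  have h3 : (⨅ d, (a d + ε * N d)) ≤ a d₁ + ε * N d₁ :=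
    ciInf_le ⟨0, by rintro _ ⟨d, rfl⟩; exact hnn d⟩ d₁
  rw [Real.dist_0_eq_abs, abs_of_nonneg (hnn _)]
  linarith [hd ε h0]

end Abstract

/-! ### Density of test functions in `L²`. -/

section TestFunctions

variable {E : Type*} [NormedAddCommGroup E] [NormedSpace ℝ E] {Ω : Set E}

theorem IsTestFunction.add {φ ψ : E → ℝ} (hφ : IsTestFunction Ω φ) (hψ : IsTestFunction Ω ψ) :
    IsTestFunction Ω (φ + ψ) :=
  ⟨hφ.smooth.add hψ.smooth, hφ.compact.add hψ.compact,
    (tsupport_add φ ψ).trans (Set.union_subset hφ.support_subset hψ.support_subset)⟩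

theorem IsTestFunction.smul {φ : E → ℝ} (hφ : IsTestFunction Ω φ) (c : ℝ) :
    IsTestFunction Ω (c • φ) :=
  ⟨contDiff_const.smul hφ.smooth, hφ.compact.smul_left (f := fun _ => c),
    (tsupport_smul_subset_right (fun _ => c) φ).trans hφ.support_subset⟩

theorem isTestFunction_zero : IsTestFunction Ω (0 : E → ℝ) :=
  ⟨contDiff_const, HasCompactSupport.zero, by simp [tsupport]⟩

variable [MeasureSpace E]

/-- The test functions as a subspace of `L²(Ω)`. -/
def testSubmodule (Ω : Set E) : Submodule ℝ (L2 Ω) where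
  carrier := {f | ∃ φ, IsTestFunction Ω φ ∧ f =ᵐ[volume.restrict Ω] φ}
  zero_mem' := ⟨0, isTestFunction_zero, Lp.coeFn_zero _ _ _⟩
  add_mem' := by
    rintro f g ⟨φ, hφ, hf⟩ ⟨ψ, hψ, hg⟩
    exact ⟨φ + ψ, hφ.add hψ, (Lp.coeFn_add f g).trans (hf.add hg)⟩
  smul_mem' := by
    rintro c f ⟨φ, hφ, hf⟩
    exact ⟨c • φ, hφ.smul c, (Lp.coeFn_smul c f).trans (hf.const_smul c)⟩

theorem mem_closure_testSubmodule [BorelSpace E] [IsFiniteMeasureOnCompacts (volume : Measure E)]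
    [FiniteDimensional ℝ E] (hΩ : IsOpen Ω) (f : L2 Ω) :
    f ∈ closure (testSubmodule Ω : Set (L2 Ω)) := by
  have h : (testSubmodule Ω).topologicalClosure = ⊤ := by
    rw [Submodule.topologicalClosure_eq_top_iff, Submodule.eq_bot_iff]
    intro g hg
    apply L2.eq_zero_of_test hΩ
    intro φ hφ
    rw [← hφ.inner_toL2]
    have hmem : hφ.toL2 ∈ testSubmodule Ω := ⟨φ, hφ, hφ.coeFn_toL2⟩
    exact Submodule.inner_left_of_mem_orthogonal hmem hg
  rw [← Submodule.topologicalClosure_coe, h]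
  trivial

end TestFunctions

/-! ### Primitives, the Poincaré inequality and approximation on the interval. -/

section Interval

variable {ℓ : ℝ}

theorem IsTestFunction.deriv {A : Set ℝ} {φ : ℝ → ℝ} (hφ : IsTestFunction A φ) :
    IsTestFunction A (deriv φ) :=
  ⟨(contDiff_infty_iff_deriv.1 hφ.smooth).2, hφ.compact.deriv,
    tsupport_deriv_subset.trans hφ.support_subset⟩

theorem isWeakDeriv_of_contDiff {A : Set ℝ} {h : ℝ → ℝ} (hh : ContDiff ℝ ∞ h) {f g : L2 A}
    (hf : f =ᵐ[volume.restrict A] h) (hg : g =ᵐ[volume.restrict A] deriv h) :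
    IsWeakDeriv A 1 f g := by
  intro φ hφ
  have h1 : ∫ x in A, f x * fderiv ℝ φ x 1 = ∫ x in A, h x * fderiv ℝ φ x 1 := by
    apply integral_congr_ae
    filter_upwards [hf] with x hx
    rw [hx]
  have h2 : ∫ x in A, g x * φ x = ∫ x in A, _root_.deriv h x * φ x := by
    apply integral_congr_ae
    filter_upwards [hg] with x hx
    rw [hx]
  rw [h1, h2, hφ.integral_mul_fderiv hh]

theorem IsTestFunction.isWeakDeriv {A : Set ℝ} {φ : ℝ → ℝ} (hφ : IsTestFunction A φ) :
    IsWeakDeriv A 1 hφ.toL2 hφ.deriv.toL2 :=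
  isWeakDeriv_of_contDiff hφ.smooth hφ.coeFn_toL2 hφ.deriv.coeFn_toL2

theorem memLp_of_continuous {h : ℝ → ℝ} (hh : Continuous h) :
    MemLp h 2 (volume.restrict (I ℓ)) := by
  obtain ⟨M, hM⟩ := isCompact_Icc.exists_bound_of_continuousOn
    (s := Set.Icc (-ℓ / 2) (ℓ / 2)) hh.continuousOn
  apply MemLp.of_bound hh.aestronglyMeasurable M
  filter_upwards [ae_restrict_mem (isOpen_I ℓ).measurableSet] with x hx
  exact hM x (Set.Ioo_subset_Icc_self hx)

theorem hasDerivAt_integral {ψ : ℝ → ℝ} (hψ : Continuous ψ) (a x : ℝ) :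
    HasDerivAt (fun t => ∫ s in a..t, ψ s) (ψ x) x :=
  intervalIntegral.integral_hasDerivAt_right (hψ.intervalIntegrable _ _)
    (hψ.stronglyMeasurableAtFilter _ _) hψ.continuousAt

theorem contDiff_integral {ψ : ℝ → ℝ} (hψ : ContDiff ℝ ∞ ψ) (a : ℝ) :
    ContDiff ℝ ∞ (fun t => ∫ s in a..t, ψ s) := by
  rw [contDiff_infty_iff_deriv]
  have h := hasDerivAt_integral hψ.continuous a
  refine ⟨fun x => (h x).differentiableAt, ?_⟩
  rwa [show _root_.deriv (fun t => ∫ s in a..t, ψ s) = ψ from funext fun x => (h x).deriv]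

/-- A test function on the interval has a smooth primitive with zero average. -/
theorem IsTestFunction.exists_primitive (hℓ : 0 < ℓ) {ψ : ℝ → ℝ} (hψ : IsTestFunction (I ℓ) ψ) :
    ∃ f : L2 (I ℓ), IsWeakDeriv (I ℓ) 1 f hψ.toL2 ∧ ∫ x in I ℓ, f x = 0 := by
  set F : ℝ → ℝ := fun t => ∫ s in (0 : ℝ)..t, ψ s
  have hF : ContDiff ℝ ∞ F := contDiff_integral hψ.smooth 0
  set c : ℝ := ℓ⁻¹ * ∫ x in I ℓ, F x
  have hFc : ContDiff ℝ ∞ (fun t => F t - c) := hF.sub contDiff_const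
  have hm := memLp_of_continuous (ℓ := ℓ) hFc.continuous
  refine ⟨hm.toLp _, isWeakDeriv_of_contDiff hFc hm.coeFn_toLp ?_, ?_⟩
  · have : _root_.deriv (fun t => F t - c) = ψ := by
      ext x
      exact ((hasDerivAt_integral hψ.smooth.continuous 0 x).sub_const c).deriv
    rw [this]
    exact hψ.coeFn_toL2
  · rw [integral_congr_ae hm.coeFn_toLp, integral_sub
      ((memLp_of_continuous hF.continuous).integrable (by norm_num)) (integrable_const c)]
    have hv : (volume.restrict (I ℓ)).real Set.univ = ℓ := by
      rw [measureReal_restrict_apply_univ, I, Real.volume_real_Ioo]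
      rw [max_eq_left (by linarith)]
      ring
    rw [integral_const, hv, smul_eq_mul]
    simp only [c]
    field_simp
    ring

/-- The primitive of a test function with zero integral is a test function. -/
theorem IsTestFunction.primitive {ψ : ℝ → ℝ} (hψ : IsTestFunction (I ℓ) ψ)
    (h0 : ∫ x in I ℓ, ψ x = 0) :
    IsTestFunction (I ℓ) (fun t => ∫ s in (-ℓ / 2)..t, ψ s) := by
  have hsm := contDiff_integral hψ.smooth (-ℓ / 2)
  by_cases hK : (tsupport ψ).Nonempty
  · have hc : IsCompact (tsupport ψ) := hψ.compact
    obtain ⟨a, ha, hamin⟩ := hc.exists_isLeast hK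
    obtain ⟨b, hb, hbmax⟩ := hc.exists_isGreatest hK
    have haI := hψ.support_subset ha
    have hbI := hψ.support_subset hb
    have hz : ∀ x, x < a ∨ b < x → ψ x = 0 := by
      intro x hx
      apply image_eq_zero_of_notMem_tsupport
      intro hx'
      rcases hx with hx | hx
      · exact absurd (hamin hx') (not_le.2 hx)
      · exact absurd (hbmax hx') (not_le.2 hx)
    have hlo : ∀ t, t < a → ∫ s in (-ℓ / 2)..t, ψ s = 0 := by
      intro t ht
      apply intervalIntegral.integral_zero_ae
      refine Filter.Eventually.of_forall fun s hs => hz s (Or.inl ?_)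
      exact (hs.2.trans_lt (max_lt haI.1 ht))
    have hhi : ∀ t, b < t → ∫ s in (-ℓ / 2)..t, ψ s = 0 := by
      intro t ht
      have hii := fun x y => hψ.smooth.continuous.intervalIntegrable (μ := volume) x y
      -- Splitting at `ℓ / 2` isolates the vanishing total integral; the remainder, on either side
      -- of `ℓ / 2`, stays to the right of `b`.
      rw [← intervalIntegral.integral_add_adjacent_intervals (hii _ (ℓ / 2)) (hii _ t)]
      have h1 : ∫ s in (-ℓ / 2)..(ℓ / 2), ψ s = 0 := by
        rw [intervalIntegral.integral_of_le (haI.1.trans haI.2).le, integral_Ioc_eq_integral_Ioo]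
        exact h0
      have h2 : ∫ s in (ℓ / 2)..t, ψ s = 0 := by
        apply intervalIntegral.integral_zero_ae
        refine Filter.Eventually.of_forall fun s hs => hz s (Or.inr ?_)
        exact (lt_min hbI.2 ht).trans hs.1
      rw [h1, h2, add_zero]
    have hsub : tsupport (fun t => ∫ s in (-ℓ / 2)..t, ψ s) ⊆ Set.Icc a b := by
      apply closure_minimal _ isClosed_Icc
      intro t ht
      constructor
      · by_contra h
        exact ht (hlo t (not_le.1 h))
      · by_contra h
        exact ht (hhi t (not_le.1 h))
    refine ⟨hsm, HasCompactSupport.of_support_subset_isCompact isCompact_Icc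
      ((subset_tsupport _).trans hsub), hsub.trans ?_⟩
    exact fun t ht => ⟨haI.1.trans_le ht.1, ht.2.trans_lt hbI.2⟩
  · have hψ0 : ψ = 0 := by
      rw [Set.not_nonempty_iff_eq_empty, tsupport_eq_empty_iff] at hK
      exact hK
    have : (fun t => ∫ s in (-ℓ / 2)..t, ψ s) = 0 := by
      ext t
      simp [hψ0]
    rw [this]
    exact isTestFunction_zero

theorem integral_abs_le (f : L2 (I ℓ)) :
    ∫ x in I ℓ, |f x| ≤ ‖f‖ * ‖Lp.const 2 (volume.restrict (I ℓ)) (1 : ℝ)‖ := by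
  have h1 : ∫ x in I ℓ, |f x| = inner ℝ |f| (Lp.const 2 (volume.restrict (I ℓ)) (1 : ℝ)) := by
    rw [inner_Lp_eq]
    apply integral_congr_ae
    filter_upwards [Lp.coeFn_abs f, Lp.coeFn_const (p := 2) (volume.restrict (I ℓ)) (1 : ℝ)]
      with x hx hx'
    rw [hx, hx', Function.const_apply, mul_one]
  rw [h1, ← norm_abs_eq_norm f]
  exact real_inner_le_norm _ _

/-- The Poincaré inequality on the interval, by duality. -/
theorem poincare (ℓ : ℝ) : ∃ C : ℝ, ∀ u u' : L2 (I ℓ), IsWeakDeriv (I ℓ) 1 u u' →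
    ∫ x in I ℓ, u x = 0 → ‖u‖ ≤ C * ‖u'‖ := by
  set one : L2 (I ℓ) := Lp.const 2 (volume.restrict (I ℓ)) (1 : ℝ)
  have hone := fun f : L2 (I ℓ) => (integral_Lp_eq_inner f).symm
  refine ⟨‖one‖ * ‖one‖, fun u u' hu h0 => ?_⟩
  have hmem := mem_closure_of_inner_eq_zero (mem_closure_testSubmodule (isOpen_I ℓ) u)
    ((hone u).trans h0)
  have hclosed : IsClosed {f : L2 (I ℓ) | |inner ℝ u f| ≤ ‖one‖ * ‖one‖ * ‖u'‖ * ‖f‖} :=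
    isClosed_le (by fun_prop) (by fun_prop)
  -- The bound on `inner ℝ u f` is proved for zero-mean test functions `f`, whose primitive is an
  -- admissible test function for `u'`; by density it extends to `f = u`.
  have hkey : |inner ℝ u u| ≤ ‖one‖ * ‖one‖ * ‖u'‖ * ‖u‖ := by
    refine closure_minimal ?_ hclosed hmem
    rintro f ⟨⟨ψ, hψ, hf⟩, hf0⟩
    rw [hone, integral_congr_ae hf] at hf0
    have hφ := hψ.primitive hf0
    have h1 : inner ℝ u f = - inner ℝ u' hφ.toL2 := by
      rw [hφ.inner_toL2, ← hu _ hφ, inner_Lp_eq]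
      apply integral_congr_ae
      filter_upwards [hf] with x hx
      rw [hx, fderiv_apply_one_eq_deriv, (hasDerivAt_integral hψ.smooth.continuous _ x).deriv]
    -- The primitive is bounded pointwise by the `L¹` norm of `f`, hence by `‖f‖ * ‖one‖`.
    have h2 : ‖hφ.toL2‖ ≤ (‖f‖ * ‖one‖) * ‖one‖ := by
      apply Lp.norm_le_mul_norm_of_ae_le_mul
      filter_upwards [hφ.coeFn_toL2, ae_restrict_mem (isOpen_I ℓ).measurableSet,
        Lp.coeFn_const (p := 2) (volume.restrict (I ℓ)) (1 : ℝ)] with x hx hxI hx1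
      rw [hx, hx1, Function.const_apply, norm_one, mul_one]
      refine le_trans ?_ (integral_abs_le f)
      rw [intervalIntegral.integral_of_le hxI.1.le]
      refine (norm_integral_le_integral_norm _).trans ?_
      have h3 : ∫ s in I ℓ, |f s| = ∫ s in I ℓ, ‖ψ s‖ := by
        apply integral_congr_ae
        filter_upwards [hf] with s hs
        rw [hs, Real.norm_eq_abs]
      rw [h3]
      apply setIntegral_mono_set
      · exact (memLp_of_continuous hψ.smooth.continuous.norm).integrable (by norm_num)
      · exact Filter.Eventually.of_forall fun s => norm_nonneg _
      · have hsub : Set.Ioc (-ℓ / 2) x ⊆ I ℓ := fun s hs => ⟨hs.1, hs.2.trans_lt hxI.2⟩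
        exact hsub.eventuallyLE
    change |inner ℝ u f| ≤ _
    rw [h1, abs_neg]
    calc |inner ℝ u' hφ.toL2| ≤ ‖u'‖ * ‖hφ.toL2‖ := abs_real_inner_le_norm _ _
      _ ≤ ‖u'‖ * ((‖f‖ * ‖one‖) * ‖one‖) := by gcongr
      _ = _ := by ring
  rw [real_inner_self_eq_norm_mul_norm, abs_of_nonneg (by positivity)] at hkey
  rcases eq_or_lt_of_le (norm_nonneg u) with h | h
  · rw [← h]
    positivity
  · exact le_of_mul_le_mul_right hkey h

/-- Approximation by test functions whose first two derivatives blow up slowly. -/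
theorem exists_test_family (g : L2 (I ℓ)) :
    ∃ (φ : ℝ → ℝ → ℝ) (hφ : ∀ ε, IsTestFunction (I ℓ) (φ ε)),
      Tendsto (fun ε => (hφ ε).toL2) (𝓝[>] 0) (𝓝 g) ∧
      Tendsto (fun ε => ε • (hφ ε).deriv.toL2) (𝓝[>] 0) (𝓝 0) ∧
      Tendsto (fun ε => ε • (hφ ε).deriv.deriv.toL2) (𝓝[>] 0) (𝓝 0) := by
  obtain ⟨d, hd⟩ := exists_tendsto_cost (D := {φ : ℝ → ℝ // IsTestFunction (I ℓ) φ})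
    (fun φ => ‖φ.2.toL2 - g‖) (fun φ => ‖φ.2.deriv.toL2‖ + ‖φ.2.deriv.deriv.toL2‖)
    (fun _ => norm_nonneg _) (fun _ => by positivity) (by
      intro η hη
      obtain ⟨f, ⟨φ, hφ, hf⟩, hd⟩ :=
        Metric.mem_closure_iff.1 (mem_closure_testSubmodule (isOpen_I ℓ) g) η hη
      refine ⟨⟨φ, hφ⟩, ?_⟩
      have : hφ.toL2 = f := Lp.ext (hφ.coeFn_toL2.trans hf.symm)
      rwa [this, ← dist_eq_norm, dist_comm])
  refine ⟨fun ε => (d ε).1, fun ε => (d ε).2, ?_, ?_, ?_⟩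
  · rw [tendsto_iff_norm_sub_tendsto_zero]
    refine squeeze_zero' (Eventually.of_forall fun _ => norm_nonneg _) ?_ hd
    filter_upwards [self_mem_nhdsWithin] with ε (hε : 0 < ε)
    exact le_add_of_nonneg_right (by positivity)
  all_goals
    rw [tendsto_zero_iff_norm_tendsto_zero]
    refine squeeze_zero' (Eventually.of_forall fun _ => norm_nonneg _) ?_ hd
    filter_upwards [self_mem_nhdsWithin] with ε (hε : 0 < ε)
    rw [norm_smul, Real.norm_eq_abs, abs_of_pos hε, mul_add]
  · linarith [norm_nonneg ((d ε).2.toL2 - g),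
      mul_nonneg hε.le (norm_nonneg (d ε).2.deriv.deriv.toL2)]
  · linarith [norm_nonneg ((d ε).2.toL2 - g), mul_nonneg hε.le (norm_nonneg (d ε).2.deriv.toL2)]

end Interval

/-! ### The two halves of the Γ-convergence. -/

section Strip

variable {ℓ : ℝ} {Q₂ : QuadraticForm ℝ Sym22}

/-- The scaled bending energy in terms of the entries of the scaled Hessian. -/
theorem Jben_eq (Q₂ : QuadraticForm ℝ Sym22) (ε : ℝ) (u : W22S ℓ) :
    Jben Q₂ ε u = 1 / 24 * ∫ x in S ℓ, Q₂ (symMat ((u.partialDeriv 0).partialDeriv 0 x)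
      ((ε⁻¹ • (u.partialDeriv 1).partialDeriv 0 : L2 (S ℓ)) x)
      (((ε ^ 2)⁻¹ • (u.partialDeriv 1).partialDeriv 1 : L2 (S ℓ)) x)) := by
  rw [Jben]
  congr 1
  apply integral_congr_ae
  filter_upwards [Lp.coeFn_smul ε⁻¹ ((u.partialDeriv 1).partialDeriv 0),
    Lp.coeFn_smul (ε ^ 2)⁻¹ ((u.partialDeriv 1).partialDeriv 1)] with x h1 h2
  rw [h1, h2]
  rfl

/-- The limit energy as an integral over the strip. -/
theorem integral_Q₁_tensor (Q₂ : QuadraticForm ℝ Sym22) (f g : L2 (I ℓ)) :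
    ∫ x in S ℓ, Q₁ Q₂ (tensor ℓ 1 f x) (tensor ℓ 1 g x) = ∫ t in I ℓ, Q₁ Q₂ (f t) (g t) := by
  rw [← integral_comp_fst]
  apply integral_congr_ae
  filter_upwards [isExtension_tensor_one f, isExtension_tensor_one g] with x h1 h2
  rw [h1, h2]

/-- The `x₁`-derivative of a function on the strip that only depends on `x₁`. -/
theorem partialDeriv_eq_tensor {f g : L2 (I ℓ)} (hfg : IsWeakDeriv (I ℓ) 1 f g) {u : W12S ℓ}
    (hu : IsExtension f u.toL2) : u.partialDeriv 0 = tensor ℓ 1 g := by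
  have h1 := u.isWeakDeriv 0
  rw [hu.eq_tensor] at h1
  exact h1.unique (isOpen_S ℓ) (hfg.tensor_fst 1)

/-- The liminf inequality. -/
theorem JLvK_le_liminf (hQ₂ : Q₂.PosDef) {ε : ℕ → ℝ} {u : ℕ → W22S ℓ} {w : W22I ℓ} {ϑ : W12I ℓ}
    (h : GradientTendsto (fun n => scaledGradient (ε n) (u n)) atTop w ϑ) :
    ((JLvK Q₂ w ϑ : ℝ) : EReal) ≤
      liminf (fun n => ((Jben Q₂ (ε n) (u n) : ℝ) : EReal)) atTop := by
  obtain ⟨G, h0, h1, hG⟩ := h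
  set p : L2 (S ℓ) := tensor ℓ 1 ((w.partialDeriv 0).partialDeriv 0)
  set q : L2 (S ℓ) := tensor ℓ 1 (ϑ.partialDeriv 0)
  have hp : (G 0).partialDeriv 0 = p :=
    partialDeriv_eq_tensor ((w.partialDeriv 0).isWeakDeriv 0) h0
  have hq : (G 1).partialDeriv 0 = q := partialDeriv_eq_tensor (ϑ.isWeakDeriv 0) h1
  have hlim : ∀ (i : Fin 2) (f : L2 (S ℓ)), Tendsto
      (fun n => inner ℝ f ((scaledGradient (ε n) (u n) i).partialDeriv 0)) atTop
      (𝓝 (inner ℝ f ((G i).partialDeriv 0))) := by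
    intro i f
    exact hG.eval (innerSL ℝ f ∘L W12.partialDerivL e (S ℓ) 0 ∘L
      (PiLp.proj 2 (fun _ : Fin 2 => W12S ℓ) i : PiLp 2 (fun _ : Fin 2 => W12S ℓ) →L[ℝ] W12S ℓ))
  have hJ : JLvK Q₂ w ϑ = 1 / 24 * ∫ x in S ℓ, Q₁ Q₂ (p x) (q x) := by
    rw [JLvK, integral_Q₁_tensor]
  set L : ℕ → ℝ := fun n => 1 / 24 * (2 * (
    coeffA Q₂ * inner ℝ p ((scaledGradient (ε n) (u n) 0).partialDeriv 0)
    + coeffC Q₂ * inner ℝ p ((scaledGradient (ε n) (u n) 1).partialDeriv 0)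
    + coeffC Q₂ * inner ℝ q ((scaledGradient (ε n) (u n) 0).partialDeriv 0)
    + coeffB Q₂ * inner ℝ q ((scaledGradient (ε n) (u n) 1).partialDeriv 0))
    - ∫ x in S ℓ, Q₁ Q₂ (p x) (q x))
  have hL : Tendsto L atTop (𝓝 (JLvK Q₂ w ϑ)) := by
    have := ((((((hlim 0 p).const_mul (coeffA Q₂)).add ((hlim 1 p).const_mul (coeffC Q₂))).add
      ((hlim 0 q).const_mul (coeffC Q₂))).add ((hlim 1 q).const_mul (coeffB Q₂))).const_mul
      2).sub_const (∫ x in S ℓ, Q₁ Q₂ (p x) (q x)) |>.const_mul (1 / 24)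
    -- At the point of tangency the tangent plane meets `Q₁`: twice the energy minus the energy.
    rw [hp, hq, ← integral_Q₁ hQ₂, two_mul, add_sub_cancel_right, ← hJ] at this
    exact this
  have hle : ∀ n, L n ≤ Jben Q₂ (ε n) (u n) := by
    intro n
    rw [Jben_eq]
    exact mul_le_mul_of_nonneg_left (integral_tangent_le hQ₂ _ _ _ _ _) (by norm_num)
  have hL' : Tendsto (fun n => ((L n : ℝ) : EReal)) atTop (𝓝 ((JLvK Q₂ w ϑ : ℝ) : EReal)) :=
    (continuous_coe_real_ereal.tendsto _).comp hL
  rw [← hL'.liminf_eq]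
  exact liminf_le_liminf (Eventually.of_forall fun n => EReal.coe_le_coe_iff.2 (hle n))

/-! ### The recovery sequence -/

/-- The polynomial `y ^ 2 / 2 - 1 / 24`, which has zero average on the cross section. -/
def quadProfile : Polynomial ℝ :=
  Polynomial.C (1 / 2) * Polynomial.X ^ 2 - Polynomial.C (1 / 24)

theorem derivative_quadProfile : Polynomial.derivative quadProfile = Polynomial.X := by
  rw [quadProfile, Polynomial.derivative_sub, Polynomial.derivative_C_mul_X_pow,
    Polynomial.derivative_C]
  norm_num

theorem integral_crossSection (f : ℝ → ℝ) :
    ∫ y in crossSection, f y = ∫ y in (-1 / 2 : ℝ)..(1 / 2), f y := by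
  rw [intervalIntegral.integral_of_le (by norm_num), integral_Ioc_eq_integral_Ioo, crossSection]

theorem integral_tensor_X (f : L2 (I ℓ)) : ∫ x in S ℓ, tensor ℓ Polynomial.X f x = 0 := by
  rw [integral_tensor, integral_crossSection]
  norm_num [Polynomial.eval_X, integral_id]

theorem integral_tensor_quadProfile (f : L2 (I ℓ)) :
    ∫ x in S ℓ, tensor ℓ quadProfile f x = 0 := by
  rw [integral_tensor, integral_crossSection]
  norm_num [quadProfile, integral_pow]

theorem integral_tensor_of_integral_eq_zero (p : Polynomial ℝ) {f : L2 (I ℓ)}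
    (hf : ∫ t in I ℓ, f t = 0) : ∫ x in S ℓ, tensor ℓ p f x = 0 := by
  rw [integral_tensor, hf, zero_mul]

variable {f f' f'' θ θ' θ'' γ γ' γ'' : L2 (I ℓ)}

/-- The element of `W^{1,2}(S)` with function
`c₀ f(x₁) p(x₂) + c₁ θ(x₁) q(x₂) + c₂ γ(x₁) r(x₂)`. -/
def W12.tensorSum (p q r : Polynomial ℝ) (c₀ c₁ c₂ : ℝ) (hf : IsWeakDeriv (I ℓ) 1 f f')
    (hθ : IsWeakDeriv (I ℓ) 1 θ θ') (hγ : IsWeakDeriv (I ℓ) 1 γ γ') : W12S ℓ :=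
  W12.mk (c₀ • tensor ℓ p f + c₁ • tensor ℓ q θ + c₂ • tensor ℓ r γ)
    ![c₀ • tensor ℓ p f' + c₁ • tensor ℓ q θ' + c₂ • tensor ℓ r γ',
      c₀ • tensor ℓ p.derivative f + c₁ • tensor ℓ q.derivative θ
        + c₂ • tensor ℓ r.derivative γ]
    (Fin.forall_fin_two.2
      ⟨(((hf.tensor_fst p).smul c₀).add ((hθ.tensor_fst q).smul c₁)).add
        ((hγ.tensor_fst r).smul c₂),
      (((isWeakDeriv_tensor_snd f p).smul c₀).add ((isWeakDeriv_tensor_snd θ q).smul c₁)).add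
        ((isWeakDeriv_tensor_snd γ r).smul c₂)⟩)

/-- The function `f(x₁) + ε x₂ θ(x₁) + ε² (x₂² / 2 - 1 / 24) γ(x₁)` in `W^{2,2}(S)`. -/
def ansatz (ε : ℝ) (hf : IsWeakDeriv (I ℓ) 1 f f') (hf' : IsWeakDeriv (I ℓ) 1 f' f'')
    (hθ : IsWeakDeriv (I ℓ) 1 θ θ') (hθ' : IsWeakDeriv (I ℓ) 1 θ' θ'')
    (hγ : IsWeakDeriv (I ℓ) 1 γ γ') (hγ' : IsWeakDeriv (I ℓ) 1 γ' γ'') : W22S ℓ :=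
  W22.mk ((1 : ℝ) • tensor ℓ 1 f + ε • tensor ℓ Polynomial.X θ + ε ^ 2 • tensor ℓ quadProfile γ)
    ![W12.tensorSum 1 Polynomial.X quadProfile 1 ε (ε ^ 2) hf' hθ' hγ',
      W12.tensorSum 0 1 Polynomial.X 1 ε (ε ^ 2) hf hθ hγ]
    (by
      have h := W12.isWeakDeriv
        (W12.tensorSum 1 Polynomial.X quadProfile 1 ε (ε ^ 2) hf hθ hγ)
      refine Fin.forall_fin_two.2 ⟨?_, ?_⟩
      · exact h 0
      · have h1 := h 1
        simpa [W12.tensorSum, W12.mk, W12.toL2, W12.partialDeriv, derivative_quadProfile] using h1)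

theorem integral_smul_add_smul_add_smul (c₀ c₁ c₂ : ℝ) (F G K : L2 (S ℓ)) :
    ∫ x in S ℓ, (c₀ • F + c₁ • G + c₂ • K : L2 (S ℓ)) x =
      c₀ * (∫ x in S ℓ, F x) + c₁ * (∫ x in S ℓ, G x) + c₂ * ∫ x in S ℓ, K x := by
  simp only [integral_Lp_eq_inner, inner_add_right, inner_smul_right]

/-- Both profiles `x₂` and `x₂² / 2 - 1 / 24` have zero mean over the cross section, so no condition
on `γ` is needed; the mean of `θ` enters only through `∂₂`. -/
theorem ansatz_zeroMean (ε : ℝ) (hf : IsWeakDeriv (I ℓ) 1 f f')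
    (hf' : IsWeakDeriv (I ℓ) 1 f' f'')
    (hθ : IsWeakDeriv (I ℓ) 1 θ θ') (hθ' : IsWeakDeriv (I ℓ) 1 θ' θ'')
    (hγ : IsWeakDeriv (I ℓ) 1 γ γ') (hγ' : IsWeakDeriv (I ℓ) 1 γ' γ'')
    (hf0 : ∫ t in I ℓ, f t = 0) (hf'0 : ∫ t in I ℓ, f' t = 0) (hθ0 : ∫ t in I ℓ, θ t = 0) :
    (ansatz ε hf hf' hθ hθ' hγ hγ').ZeroMean := by
  refine ⟨?_, Fin.forall_fin_two.2 ⟨?_, ?_⟩⟩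
  · refine (integral_smul_add_smul_add_smul _ _ _ _ _ _).trans ?_
    rw [integral_tensor_of_integral_eq_zero 1 hf0, integral_tensor_X,
      integral_tensor_quadProfile]
    ring
  · refine (integral_smul_add_smul_add_smul _ _ _ _ _ _).trans ?_
    rw [integral_tensor_of_integral_eq_zero 1 hf'0, integral_tensor_X,
      integral_tensor_quadProfile]
    ring
  · refine (integral_smul_add_smul_add_smul _ _ _ _ _ _).trans ?_
    rw [integral_tensor_of_integral_eq_zero 0 hf0, integral_tensor_of_integral_eq_zero 1 hθ0,
      integral_tensor_X]
    ring

theorem tensor_zero : tensor ℓ 0 = 0 := ContinuousLinearMap.ext tensor_zero_left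

/-- `ε⁻¹ ∂₂` of the ansatz. -/
theorem inv_smul_tensorSum {ε : ℝ} (hε : ε ≠ 0) (hf : IsWeakDeriv (I ℓ) 1 f f')
    (hθ : IsWeakDeriv (I ℓ) 1 θ θ') (hγ : IsWeakDeriv (I ℓ) 1 γ γ') :
    ε⁻¹ • W12.tensorSum 0 1 Polynomial.X 1 ε (ε ^ 2) hf hθ hγ =
      W12.tensorSum 1 Polynomial.X 0 1 ε (ε ^ 2) hθ hγ hγ := by
  have key : ∀ F G : L2 (S ℓ), ε⁻¹ • (ε • F + ε ^ 2 • G) = F + ε • G := by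
    intro F G
    rw [smul_add, smul_smul, smul_smul, inv_mul_cancel₀ hε, one_smul]
    congr 2
    field_simp
  apply Subtype.ext
  apply WithLp.ofLp_injective
  refine Prod.ext ?_ (PiLp.ext (Fin.forall_fin_two.2 ⟨?_, ?_⟩))
  · simpa [W12.tensorSum, W12.mk, tensor_zero] using key (tensor ℓ 1 θ) (tensor ℓ Polynomial.X γ)
  · simpa [W12.tensorSum, W12.mk, tensor_zero] using
      key (tensor ℓ 1 θ') (tensor ℓ Polynomial.X γ')
  · simpa [W12.tensorSum, W12.mk, tensor_zero] using key 0 (tensor ℓ 1 γ)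

/-! ### Strong limits of the ansatz and its derivatives. -/

section Limits

variable {F F' Θ Θ' Θ'' Γ Γ' Γ'' : ℝ → L2 (I ℓ)}

theorem tendsto_smul_zero (hF : Tendsto F (𝓝[>] 0) (𝓝 f)) :
    Tendsto (fun ε => ε • F ε) (𝓝[>] 0) (𝓝 0) := by
  have h : Tendsto (fun ε : ℝ => ε) (𝓝[>] 0) (𝓝 0) := tendsto_nhdsWithin_of_tendsto_nhds tendsto_id
  simpa using h.smul hF

/-- The principal term dominates in a sum of products. -/
theorem tendsto_smul_add_smul_add_smul (p q r : Polynomial ℝ) (φ ψ : L2 (I ℓ))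
    (hF : Tendsto F (𝓝[>] 0) (𝓝 f)) (hΘ : Tendsto (fun ε => ε • Θ ε) (𝓝[>] 0) (𝓝 0))
    (hΓ : Tendsto (fun ε => ε • Γ ε) (𝓝[>] 0) (𝓝 0)) :
    Tendsto (fun ε => (1 : ℝ) • tensor ℓ p (F ε) + ε • tensor ℓ q (Θ ε)
      + ε ^ 2 • tensor ℓ r (Γ ε)) (𝓝[>] 0)
      (𝓝 ((1 : ℝ) • tensor ℓ p f + (0 : ℝ) • tensor ℓ q φ + (0 : ℝ) ^ 2 • tensor ℓ r ψ)) := by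
  have h1 := ((tensor ℓ p).continuous.tendsto _).comp hF
  have h2 := ((tensor ℓ q).continuous.tendsto _).comp hΘ
  have h3 := ((tensor ℓ r).continuous.tendsto _).comp
    (tendsto_smul_zero (F := fun ε => ε • Γ ε) hΓ)
  have h4 := (h1.add h2).add h3
  simpa [Function.comp_def, smul_smul, pow_two] using h4

/-- Writing the limit as a `W12.tensorSum` with coefficients `0` supplies its weak derivatives at
once; `θ` and `γ` are then mere placeholders. The families `Θ`, `Γ` and their derivatives may
diverge, as long as their products with `ε` vanish. -/
theorem tendsto_tensorSum (p q r : Polynomial ℝ) (hF : ∀ ε, IsWeakDeriv (I ℓ) 1 (F ε) (F' ε))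
    (hΘ : ∀ ε, IsWeakDeriv (I ℓ) 1 (Θ ε) (Θ' ε)) (hΓ : ∀ ε, IsWeakDeriv (I ℓ) 1 (Γ ε) (Γ' ε))
    (hf : IsWeakDeriv (I ℓ) 1 f f') (hθ : IsWeakDeriv (I ℓ) 1 θ θ')
    (hγ : IsWeakDeriv (I ℓ) 1 γ γ')
    (tF : Tendsto F (𝓝[>] 0) (𝓝 f)) (tF' : Tendsto F' (𝓝[>] 0) (𝓝 f'))
    (tΘ : Tendsto (fun ε => ε • Θ ε) (𝓝[>] 0) (𝓝 0))
    (tΘ' : Tendsto (fun ε => ε • Θ' ε) (𝓝[>] 0) (𝓝 0))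
    (tΓ : Tendsto (fun ε => ε • Γ ε) (𝓝[>] 0) (𝓝 0))
    (tΓ' : Tendsto (fun ε => ε • Γ' ε) (𝓝[>] 0) (𝓝 0)) :
    Tendsto (fun ε => W12.tensorSum p q r 1 ε (ε ^ 2) (hF ε) (hΘ ε) (hΓ ε)) (𝓝[>] 0)
      (𝓝 (W12.tensorSum p q r 1 0 (0 ^ 2) hf hθ hγ)) :=
  W12.tendsto (tendsto_smul_add_smul_add_smul p q r θ γ tF tΘ tΓ)
    (Fin.forall_fin_two.2
      ⟨tendsto_smul_add_smul_add_smul p q r θ' γ' tF' tΘ' tΓ',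
        tendsto_smul_add_smul_add_smul _ _ _ θ γ tF tΘ tΓ⟩)

end Limits

theorem isExtension_of_eq {F : L2 (S ℓ)} (h : F = tensor ℓ 1 f) : IsExtension f F :=
  h ▸ isExtension_tensor_one f

theorem isExtension_tensorSum (q r : Polynomial ℝ) (hf : IsWeakDeriv (I ℓ) 1 f f')
    (hθ : IsWeakDeriv (I ℓ) 1 θ θ') (hγ : IsWeakDeriv (I ℓ) 1 γ γ') :
    IsExtension f (W12.tensorSum 1 q r 1 0 (0 ^ 2) hf hθ hγ).toL2 :=
  isExtension_of_eq (by simp [W12.toL2, W12.tensorSum, W12.mk])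

/-- With the optimal last entry inserted, the limit energy is the same `Q₂` functional as the
bending energy, so strong convergence of the entries suffices. -/
theorem JLvK_eq (hQ₂ : Q₂.PosDef) (w : W22I ℓ) (ϑ : W12I ℓ) :
    JLvK Q₂ w ϑ = 1 / 24 * ∫ x in S ℓ,
      Q₂ (symMat (tensor ℓ 1 ((w.partialDeriv 0).partialDeriv 0) x)
        (tensor ℓ 1 (ϑ.partialDeriv 0) x)
        (tensor ℓ 1 (optA Q₂ • (w.partialDeriv 0).partialDeriv 0
          + optB Q₂ • ϑ.partialDeriv 0) x)) := by
  rw [JLvK, ← integral_Q₁_tensor]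
  congr 1
  apply integral_congr_ae
  rw [map_add, map_smul, map_smul]
  generalize tensor ℓ 1 ((w.partialDeriv 0).partialDeriv 0) = p
  generalize tensor ℓ 1 (ϑ.partialDeriv 0) = q
  filter_upwards [Lp.coeFn_add (optA Q₂ • p) (optB Q₂ • q), Lp.coeFn_smul (optA Q₂) p,
    Lp.coeFn_smul (optB Q₂) q] with x h2 h3 h4
  rw [h2, Pi.add_apply, h3, h4]
  exact Q₁_eq hQ₂ _ _

theorem tendsto_Jben (hQ₂ : Q₂.PosDef) {u : ℝ → W22S ℓ} {w : W22I ℓ} {ϑ : W12I ℓ}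
    (tp : Tendsto (fun ε => ((u ε).partialDeriv 0).partialDeriv 0) (𝓝[>] 0)
      (𝓝 (tensor ℓ 1 ((w.partialDeriv 0).partialDeriv 0))))
    (tq : Tendsto (fun ε => ε⁻¹ • ((u ε).partialDeriv 1).partialDeriv 0) (𝓝[>] 0)
      (𝓝 (tensor ℓ 1 (ϑ.partialDeriv 0))))
    (tr : Tendsto (fun ε => (ε ^ 2)⁻¹ • ((u ε).partialDeriv 1).partialDeriv 1) (𝓝[>] 0)
      (𝓝 (tensor ℓ 1 (optA Q₂ • (w.partialDeriv 0).partialDeriv 0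
        + optB Q₂ • ϑ.partialDeriv 0)))) :
    Tendsto (fun ε => Jben Q₂ ε (u ε)) (𝓝[>] 0) (𝓝 (JLvK Q₂ w ϑ)) := by
  rw [JLvK_eq hQ₂]
  simp only [Jben_eq]
  exact (tendsto_integral_quadraticForm Q₂ tp tq tr).const_mul _

/-- The existence of recovery sequences. -/
theorem exists_recovery (hℓ : 0 < ℓ) (hQ₂ : Q₂.PosDef) {w : W22I ℓ} {ϑ : W12I ℓ}
    (hw : w.ZeroMean) (hϑ : ϑ.ZeroMean) :
    ∃ u : ℝ → W22S ℓ, (∀ ε, (u ε).ZeroMean) ∧ DisplacementTendsto u (𝓝[>] 0) w ∧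
      GradientTendsto (fun ε => scaledGradient ε (u ε)) (𝓝[>] 0) w ϑ ∧
      Tendsto (fun ε => Jben Q₂ ε (u ε)) (𝓝[>] 0) (𝓝 (JLvK Q₂ w ϑ)) := by
  have hw1 : IsWeakDeriv (I ℓ) 1 w.toL2 (w.partialDeriv 0).toL2 := w.isWeakDeriv 0
  have hw2 := (w.partialDeriv 0).isWeakDeriv 0
  have hϑ1 := ϑ.isWeakDeriv 0
  set w'' : L2 (I ℓ) := (w.partialDeriv 0).partialDeriv 0
  set ϑ' : L2 (I ℓ) := ϑ.partialDeriv 0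
  set γ₀ : L2 (I ℓ) := optA Q₂ • w'' + optB Q₂ • ϑ'
  obtain ⟨g, hg, tg, tg', -⟩ := exists_test_family ϑ'
  obtain ⟨γ, hγ, tγ, tγ', tγ''⟩ := exists_test_family γ₀
  choose θ hθ hθ0 using fun ε => (hg ε).exists_primitive hℓ
  -- `θ ε - ϑ` has zero mean, so the Poincaré inequality bounds it by its derivative, the
  -- approximation error of `ϑ'`.
  have tθ : Tendsto θ (𝓝[>] 0) (𝓝 ϑ.toL2) := by
    obtain ⟨C, hC⟩ := poincare ℓ
    rw [tendsto_iff_norm_sub_tendsto_zero] at tg ⊢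
    have hlim := tg.const_mul C
    rw [mul_zero] at hlim
    refine squeeze_zero (fun _ => norm_nonneg _) (fun ε => ?_) hlim
    refine hC _ _ ((hθ ε).sub hϑ1) ?_
    have h1 : ∫ t in I ℓ, ϑ.toL2 t = 0 := hϑ
    have h2 := hθ0 ε
    rw [integral_Lp_eq_inner] at h1 h2 ⊢
    rw [inner_sub_right, h1, h2, sub_zero]
  set u : ℝ → W22S ℓ := fun ε => ansatz ε hw1 hw2 (hθ ε) (hg ε).isWeakDeriv (hγ ε).isWeakDeriv
    (hγ ε).deriv.isWeakDeriv
  have tD0 := tendsto_tensorSum 1 Polynomial.X quadProfile (fun _ => hw2)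
    (fun ε => (hg ε).isWeakDeriv) (fun ε => (hγ ε).deriv.isWeakDeriv) hw2 hw2 hw2
    tendsto_const_nhds tendsto_const_nhds (tendsto_smul_zero tg) tg' tγ' tγ''
  have tD1 := tendsto_tensorSum 0 1 Polynomial.X (fun _ => hw1) hθ (fun ε => (hγ ε).isWeakDeriv)
    hw1 hw1 hw1 tendsto_const_nhds tendsto_const_nhds (tendsto_smul_zero tθ)
    (tendsto_smul_zero tg) (tendsto_smul_zero tγ) tγ'
  have tG1 := tendsto_tensorSum 1 Polynomial.X 0 hθ (fun ε => (hγ ε).isWeakDeriv)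
    (fun ε => (hγ ε).isWeakDeriv) hϑ1 hϑ1 hϑ1 tθ tg (tendsto_smul_zero tγ) tγ'
    (tendsto_smul_zero tγ) tγ'
  have tG1' : Tendsto (fun ε => ε⁻¹ • (u ε).partialDeriv 1) (𝓝[>] 0)
      (𝓝 (W12.tensorSum 1 Polynomial.X 0 1 0 (0 ^ 2) hϑ1 hϑ1 hϑ1)) := by
    refine tG1.congr' ?_
    filter_upwards [self_mem_nhdsWithin] with ε (hε : 0 < ε)
    exact (inv_smul_tensorSum hε.ne' hw1 _ _).symm
  refine ⟨u, fun ε => ansatz_zeroMean ε _ _ _ _ _ _ hw.1 (hw.2 0) (hθ0 ε), ?_, ?_, ?_⟩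
  · exact ⟨ansatz 0 hw1 hw2 hw1 hw2 hw1 hw2,
      isExtension_tensorSum Polynomial.X quadProfile hw1 hw1 hw1,
      W22.weakTendsto (tendsto_smul_add_smul_add_smul 1 Polynomial.X quadProfile _ _
        tendsto_const_nhds (tendsto_smul_zero tθ) (tendsto_smul_zero tγ))
        (Fin.forall_fin_two.2 ⟨tD0, tD1⟩)⟩
  · refine ⟨WithLp.toLp 2 ![W12.tensorSum 1 Polynomial.X quadProfile 1 0 (0 ^ 2) hw2 hw2 hw2,
      W12.tensorSum 1 Polynomial.X 0 1 0 (0 ^ 2) hϑ1 hϑ1 hϑ1], isExtension_tensorSum _ _ hw2 hw2 hw2,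
      isExtension_tensorSum _ _ hϑ1 hϑ1 hϑ1, WeakTendsto.of_tendsto ?_⟩
    refine ((PiLp.continuous_toLp 2 (fun _ : Fin 2 => W12S ℓ)).tendsto _).comp ?_
    exact tendsto_pi_nhds.2 (Fin.forall_fin_two.2 ⟨tD0, tG1'⟩)
  · have tp : Tendsto (fun ε => ((u ε).partialDeriv 0).partialDeriv 0) (𝓝[>] 0)
        (𝓝 (tensor ℓ 1 w'')) := by
      have := ((W12.partialDerivL e (S ℓ) 0).continuous.tendsto _).comp tD0
      have h0 : W12.partialDerivL e (S ℓ) 0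
          (W12.tensorSum 1 Polynomial.X quadProfile 1 0 (0 ^ 2) hw2 hw2 hw2) = tensor ℓ 1 w'' := by
        simp [W12.partialDerivL_apply, W12.partialDeriv, W12.tensorSum, W12.mk, w'']
      rwa [h0] at this
    have tq : Tendsto (fun ε => ε⁻¹ • ((u ε).partialDeriv 1).partialDeriv 0) (𝓝[>] 0)
        (𝓝 (tensor ℓ 1 ϑ')) := by
      have := ((W12.partialDerivL e (S ℓ) 0).continuous.tendsto _).comp tG1'
      have h0 : W12.partialDerivL e (S ℓ) 0
          (W12.tensorSum 1 Polynomial.X 0 1 0 (0 ^ 2) hϑ1 hϑ1 hϑ1) = tensor ℓ 1 ϑ' := by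
        simp [W12.partialDerivL_apply, W12.partialDeriv, W12.tensorSum, W12.mk, ϑ']
      rwa [h0] at this
    have tr : Tendsto (fun ε => (ε ^ 2)⁻¹ • ((u ε).partialDeriv 1).partialDeriv 1) (𝓝[>] 0)
        (𝓝 (tensor ℓ 1 γ₀)) := by
      refine Tendsto.congr' ?_ (((tensor ℓ 1).continuous.tendsto _).comp tγ)
      filter_upwards [self_mem_nhdsWithin] with ε (hε : 0 < ε)
      -- The second derivative of the quadratic profile is `1`, so the scaled (2,2) entry is exactly
      -- the approximant of the optimal `γ₀`.
      have h1 : ((u ε).partialDeriv 1).partialDeriv 1 = ε ^ 2 • tensor ℓ 1 (hγ ε).toL2 := by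
        change (1 : ℝ) • tensor ℓ (Polynomial.derivative 0) _
          + ε • tensor ℓ (Polynomial.derivative 1) _
          + ε ^ 2 • tensor ℓ (Polynomial.derivative Polynomial.X) _ = _
        simp [tensor_zero]
      rw [h1, smul_smul, inv_mul_cancel₀ (pow_ne_zero 2 hε.ne'), one_smul]
      rfl
    exact tendsto_Jben hQ₂ tp tq tr

end Strip

end

end NarrowStrip

theorem theorem2p1 (ℓ : ℝ) (hℓ : 0 < ℓ)
    (Q₂ : QuadraticForm ℝ NarrowStrip.Sym22) (hQ₂ : Q₂.PosDef) :
    -- liminf inequality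
    (∀ (ε : ℕ → ℝ) (u : ℕ → NarrowStrip.W22S ℓ) (w : NarrowStrip.W22I ℓ) (ϑ : NarrowStrip.W12I ℓ),
      (∀ n, 0 < ε n) → Tendsto ε atTop (𝓝 0) →
      (∀ n, (u n).ZeroMean) → w.ZeroMean → ϑ.ZeroMean →
      NarrowStrip.DisplacementTendsto u atTop w →
      NarrowStrip.GradientTendsto (fun n => NarrowStrip.scaledGradient (ε n) (u n)) atTop w ϑ →
      ((NarrowStrip.JLvK Q₂ w ϑ : ℝ) : EReal) ≤
        liminf (fun n => ((NarrowStrip.Jben Q₂ (ε n) (u n) : ℝ) : EReal)) atTop) ∧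
    -- recovery sequence
    (∀ (w : NarrowStrip.W22I ℓ) (ϑ : NarrowStrip.W12I ℓ), w.ZeroMean → ϑ.ZeroMean →
      ∃ u : ℝ → NarrowStrip.W22S ℓ,
        (∀ ε, 0 < ε → (u ε).ZeroMean) ∧
        NarrowStrip.DisplacementTendsto u (𝓝[>] 0) w ∧
        NarrowStrip.GradientTendsto (fun ε => NarrowStrip.scaledGradient ε (u ε)) (𝓝[>] 0) w ϑ ∧
        limsup (fun ε => ((NarrowStrip.Jben Q₂ ε (u ε) : ℝ) : EReal)) (𝓝[>] 0) ≤
          ((NarrowStrip.JLvK Q₂ w ϑ : ℝ) : EReal)) := by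
  refine ⟨fun ε u w ϑ _ _ _ _ _ _ h => NarrowStrip.JLvK_le_liminf hQ₂ h, fun w ϑ hw hϑ => ?_⟩
  obtain ⟨u, hu, hd, hg, hJ⟩ := NarrowStrip.exists_recovery hℓ hQ₂ hw hϑ
  exact ⟨u, fun ε _ => hu ε, hd, hg,
    ((continuous_coe_real_ereal.tendsto _).comp hJ).limsup_eq.le⟩
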